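/- Let $k$ be a field and $r \ge 0$ an integer. By a curve $C \subset \mathbb{P}^r = \mathbb{P}^r_k$ we mean a closed subscheme all of whose irreducible components have dimension one and which has no embedded points ($C$ may be singular, reducible or non-reduced); it has degree $d$ and (arithmetic) genus $g$ if its Hilbert polynomial is $P(x) = dx + 1 - g$, i.e. $\dim_k H^0(C, \mathcal{O}_C(m)) = dm + 1 - g$ for all sufficiently large $m$. It is nondegenerate if it is not contained, as a subscheme, in any hyperplane of $\mathbb{P}^r$. Let $C \subset \mathbb{P}^r$ be a nondegenerate curve of degree $d$ and genus $g$ with $H^1(C, \mathcal{O}_C(2)) = 0$, and suppose that $$d < g + r \qquad\text{and}\qquad 4d - 2g < r(r+3).$$ Then for every hyperplane $H \subset \mathbb{P}^r$ that contains no irreducible component of $C$ (in particular for a general hyperplane if $k$ is infinite, and for every hyperplane if $C$ is integral), the restriction map $$H^0(\mathcal{O}_H(2)) \longrightarrow H^0(\mathcal{O}_{C \cap H}(2)),$$ where $C \cap H$ is the scheme-theoretic intersection, fails to have maximal rank: it is neither injective nor surjective. -/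

import Mathlib

open CategoryTheory AlgebraicGeometry

universe u

namespace HyperplaneSection

noncomputable section

/-- The standard grading of the polynomial ring `k[x_0, …, x_r]` by degree. -/
abbrev gr (k : Type u) [Field k] (r : ℕ) : ℕ → Submodule k (MvPolynomial (Fin (r + 1)) k) :=
  MvPolynomial.homogeneousSubmodule (Fin (r + 1)) k

instance gradedAlgebra (k : Type u) [Field k] (r : ℕ) : GradedAlgebra (gr k r) :=
  MvPolynomial.gradedAlgebra

/-- Projective space `ℙ^r` over `k`. -/
abbrev PP (k : Type u) [Field k] (r : ℕ) : Scheme.{u} := Proj (gr k r)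

variable {k : Type u} [Field k] {r : ℕ}

lemma coord_mem (k : Type u) [Field k] {r : ℕ} (a : Fin (r + 1)) :
    (MvPolynomial.X a : MvPolynomial (Fin (r + 1)) k) ∈ gr k r 1 :=
  MvPolynomial.isHomogeneous_X k a

/-- The standard affine open `D₊(x_a)` of `ℙ^r`. -/
def stdOpen (k : Type u) [Field k] {r : ℕ} (a : Fin (r + 1)) : (PP k r).Opens :=
  Proj.basicOpen (gr k r) (MvPolynomial.X a)

/-- The regular function `x_a / x_b` on `D₊(x_b)`. -/
def ratio (k : Type u) [Field k] {r : ℕ} (a b : Fin (r + 1)) : Γ(PP k r, stdOpen k b) :=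
  (Proj.awayToSection (gr k r) (MvPolynomial.X b)).hom
    (HomogeneousLocalization.Away.mk (gr k r) (coord_mem k b) 1 (MvPolynomial.X a)
      (by simpa using coord_mem k a))

/-- The structure morphism `ℙ^r ⟶ Spec k`. -/
def toBase (k : Type u) [Field k] (r : ℕ) : PP k r ⟶ Spec (.of k) :=
  Proj.toSpecZero (gr k r) ≫ Spec.map (CommRingCat.ofHom (algebraMap k (gr k r 0)))

/-- The homology `ker g / im f` of linear maps `A → B → C` (with `g ∘ f = 0`). -/
abbrev Homology {A B C : Type u} [AddCommGroup A] [AddCommGroup B] [AddCommGroup C]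
    [Module k A] [Module k B] [Module k C] (f : A →ₗ[k] B) (g : B →ₗ[k] C) : Type u :=
  LinearMap.ker g ⧸ (LinearMap.range f).submoduleOf (LinearMap.ker g)

section Twist

variable {X : Scheme.{u}}

/-- The ring `Γ(X, U)` of regular functions, for a scheme `X` over `ℙ^r` (hence over `k`). -/
def Fun (_i : X ⟶ PP k r) (U : X.Opens) : Type u := Γ(X, U)

lemma le_preimage_top {Y : Scheme.{u}} (f : X ⟶ Y) (U : X.Opens) : U ≤ f ⁻¹ᵁ ⊤ := le_top

variable (i : X ⟶ PP k r)

instance Fun.commRing (U : X.Opens) : CommRing (Fun i U) := inferInstanceAs (CommRing Γ(X, U))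

instance Fun.algebra (U : X.Opens) : Algebra k (Fun i U) :=
  RingHom.toAlgebra (R := k) (S := Γ(X, U))
    ((Scheme.ΓSpecIso (.of k)).inv ≫ (i ≫ toBase k r).appLE ⊤ U (le_preimage_top _ _)).hom

/-- For `f : Y ⟶ X` and `V` contained in `f⁻¹ U`, pullback of functions from `U` to `V`. -/
def Fun.pull {Y : Scheme.{u}} (f : Y ⟶ X) {U : X.Opens} {V : Y.Opens} (h : V ≤ f ⁻¹ᵁ U) :
    Fun i U →ₐ[k] Fun (f ≫ i) V where
  toRingHom := (f.appLE U V h).hom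
  commutes' c := by
    change ((Scheme.ΓSpecIso (.of k)).inv ≫ (i ≫ toBase k r).appLE ⊤ U (le_preimage_top _ _) ≫
      f.appLE U V h).hom c = ((Scheme.ΓSpecIso (.of k)).inv ≫
      ((f ≫ i) ≫ toBase k r).appLE ⊤ V (le_preimage_top _ _)).hom c
    rw [Scheme.Hom.appLE_comp_appLE, Category.assoc]

/-- Restriction of functions. -/
def Fun.res {U V : X.Opens} (h : V ≤ U) : Fun i U →ₐ[k] Fun i V where
  toRingHom := (X.presheaf.map (homOfLE h).op).hom
  commutes' c := by
    change ((Scheme.ΓSpecIso (.of k)).inv ≫ (i ≫ toBase k r).appLE ⊤ U (le_preimage_top _ _) ≫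
      X.presheaf.map (homOfLE h).op).hom c = ((Scheme.ΓSpecIso (.of k)).inv ≫
      (i ≫ toBase k r).appLE ⊤ V (le_preimage_top _ _)).hom c
    rw [Scheme.Hom.appLE_map]

/-- The open subset `X_a` of `X` where the coordinate `x_a` does not vanish. -/
abbrev chart (a : Fin (r + 1)) : X.Opens := i ⁻¹ᵁ stdOpen k a

/-- The function `x_a / x_b` on an open subset of `X_b`. -/
def coord (a b : Fin (r + 1)) {U : X.Opens} (h : U ≤ chart i b) : Fun i U :=
  (i.appLE (stdOpen k b) U h).hom (ratio k a b)

/-- The sections `Γ(U, 𝒪_X(m))` of the pullback of the line bundle `𝒪(m)` on `ℙ^r`, glued from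
the trivial bundles on the charts `X_a` by the transition functions `(x_a / x_b) ^ m`:
a section `s` is given by the functions `s_a = s / x_a ^ m` on `U ∩ X_a`, which satisfy
`s_b = (x_a / x_b) ^ m * s_a` on `U ∩ X_a ∩ X_b`. -/
def Sec (m : ℕ) (U : X.Opens) : Submodule k (∀ a, Fun i (U ⊓ chart i a)) where
  carrier := {s | ∀ a b,
    Fun.res i (inf_le_right : chart i a ⊓ (U ⊓ chart i b) ≤ U ⊓ chart i b) (s b) =
      coord i a b (inf_le_right.trans inf_le_right) ^ m *
        Fun.res i (le_inf (inf_le_right.trans inf_le_left) inf_le_left) (s a)}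
  add_mem' hs ht a b := by
    simp only [Pi.add_apply, map_add, mul_add, hs a b, ht a b]
  zero_mem' a b := by simp
  smul_mem' c s hs a b := by
    simp only [Pi.smul_apply, map_smul, hs a b, mul_smul_comm]

lemma Fun.res_res {U V W : X.Opens} (h : V ≤ U) (h' : W ≤ V) (s : Fun i U) :
    Fun.res i h' (Fun.res i h s) = Fun.res i (h'.trans h) s := by
  change (X.presheaf.map (homOfLE h).op ≫ X.presheaf.map (homOfLE h').op).hom s =
    (X.presheaf.map (homOfLE (h'.trans h)).op).hom s
  rw [← X.presheaf.map_comp]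
  rfl

lemma Fun.res_coord (a b : Fin (r + 1)) {U V : X.Opens} (h : U ≤ chart i b) (h' : V ≤ U) :
    Fun.res i h' (coord i a b h) = coord i a b (h'.trans h) := by
  change (i.appLE (stdOpen k b) U h ≫ X.presheaf.map (homOfLE h').op).hom _ = _
  rw [Scheme.Hom.appLE_map]
  rfl

/-- Restriction of sections of `𝒪_X(m)`. -/
def Sec.res (m : ℕ) {U V : X.Opens} (h : V ≤ U) : Sec i m U →ₗ[k] Sec i m V :=
  LinearMap.restrict
    (LinearMap.pi fun a =>
      (Fun.res i (inf_le_inf_right (chart i a) h)).toLinearMap ∘ₗ LinearMap.proj a)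
    (by
      intro s hs a b
      have key := congrArg
        (Fun.res i (inf_le_inf_left (chart i a) (inf_le_inf_right (chart i b) h))) (hs a b)
      simp only [map_mul, map_pow, Fun.res_res, Fun.res_coord] at key
      simpa [Fun.res_res] using key)

/-- `H⁰(X, 𝒪_X(m))`. -/
abbrev H0 (m : ℕ) : Type u := Sec i m ⊤

/-- The first Čech differential for `𝒪_X(m)` and the cover of `X` by the charts `X_a`. -/
def cechD0 (m : ℕ) :
    (∀ a, Sec i m (chart i a)) →ₗ[k] (∀ a b, Sec i m (chart i a ⊓ chart i b)) :=
  LinearMap.pi fun a => LinearMap.pi fun b =>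
    Sec.res i m inf_le_right ∘ₗ LinearMap.proj b - Sec.res i m inf_le_left ∘ₗ LinearMap.proj a

/-- The second Čech differential for `𝒪_X(m)` and the cover of `X` by the charts `X_a`. -/
def cechD1 (m : ℕ) :
    (∀ a b, Sec i m (chart i a ⊓ chart i b)) →ₗ[k]
      (∀ a b c, Sec i m (chart i a ⊓ chart i b ⊓ chart i c)) :=
  LinearMap.pi fun a => LinearMap.pi fun b => LinearMap.pi fun c =>
    Sec.res i m (le_inf (inf_le_left.trans inf_le_right) inf_le_right) ∘ₗ
        LinearMap.proj c ∘ₗ LinearMap.proj b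
      - Sec.res i m (le_inf (inf_le_left.trans inf_le_left) inf_le_right) ∘ₗ
        LinearMap.proj c ∘ₗ LinearMap.proj a
      + Sec.res i m inf_le_left ∘ₗ LinearMap.proj b ∘ₗ LinearMap.proj a

/-- `H¹(X, 𝒪_X(m))`, computed by the Čech complex of the cover of `X` by the charts `X_a`
(which are affine when `X` is a closed subscheme of `ℙ^r`). -/
abbrev H1 (m : ℕ) : Type u := Homology (cechD0 i m) (cechD1 i m)

lemma Fun.res_pull {Y : Scheme.{u}} (f : Y ⟶ X) {U U' : X.Opens} {V V' : Y.Opens}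
    (h : V ≤ f ⁻¹ᵁ U) (h' : V' ≤ V) (hU : U' ≤ U) (h'' : V' ≤ f ⁻¹ᵁ U') (s : Fun i U) :
    Fun.res (f ≫ i) h' (Fun.pull i f h s) = Fun.pull i f h'' (Fun.res i hU s) := by
  change (f.appLE U V h ≫ Y.presheaf.map (homOfLE h').op).hom s =
    (X.presheaf.map (homOfLE hU).op ≫ f.appLE U' V' h'').hom s
  rw [Scheme.Hom.appLE_map, Scheme.Hom.map_appLE]

lemma Fun.pull_coord {Y : Scheme.{u}} (f : Y ⟶ X) (a b : Fin (r + 1)) {U : X.Opens}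
    {V : Y.Opens} (h : U ≤ chart i b) (h' : V ≤ f ⁻¹ᵁ U) (h'' : V ≤ chart (f ≫ i) b) :
    Fun.pull i f h' (coord i a b h) = coord (f ≫ i) a b h'' := by
  change (i.appLE (stdOpen k b) U h ≫ f.appLE U V h').hom _ = _
  rw [Scheme.Hom.appLE_comp_appLE]
  rfl

lemma le_preimage {Y : Scheme.{u}} (f : Y ⟶ X) (a : Fin (r + 1)) :
    ⊤ ⊓ chart (f ≫ i) a ≤ f ⁻¹ᵁ (⊤ ⊓ chart i a) := le_rfl

lemma le_preimage' {Y : Scheme.{u}} (f : Y ⟶ X) (a b : Fin (r + 1)) :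
    chart (f ≫ i) a ⊓ (⊤ ⊓ chart (f ≫ i) b) ≤ f ⁻¹ᵁ (chart i a ⊓ (⊤ ⊓ chart i b)) := le_rfl

lemma le_preimage'' {Y : Scheme.{u}} (f : Y ⟶ X) (a b : Fin (r + 1)) :
    chart (f ≫ i) a ⊓ (⊤ ⊓ chart (f ≫ i) b) ≤ f ⁻¹ᵁ (⊤ ⊓ chart i b) := inf_le_right

/-- The pullback of sections `H⁰(X, 𝒪_X(m)) → H⁰(Y, 𝒪_Y(m))` along a morphism `f : Y ⟶ X` of
schemes over `ℙ^r`. For a closed subscheme `Y` of `X` this is the restriction map. -/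
def pullback {Y : Scheme.{u}} (f : Y ⟶ X) (m : ℕ) : H0 i m →ₗ[k] H0 (f ≫ i) m :=
  LinearMap.restrict
    (LinearMap.pi fun a =>
      (Fun.pull i f (le_preimage i f a)).toLinearMap ∘ₗ LinearMap.proj a)
    (by
      intro s hs a b
      have key := congrArg (Fun.pull i f (le_preimage' i f a b)) (hs a b)
      rw [map_mul, map_pow, Fun.pull_coord i f a b _ _ (inf_le_right.trans inf_le_right)] at key
      simp only [LinearMap.pi_apply, LinearMap.comp_apply, LinearMap.proj_apply,
        AlgHom.toLinearMap_apply]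
      rw [Fun.res_pull i f _ inf_le_right inf_le_right (le_preimage' i f a b),
        Fun.res_pull i f _ _ (le_inf (inf_le_right.trans inf_le_left) inf_le_left)
          (le_preimage' i f a b)]
      exact key)

end Twist

/-- A linear map has maximal rank if it is injective or surjective. -/
def MaximalRank {V W : Type*} [AddCommGroup V] [AddCommGroup W] [Module k V] [Module k W]
    (φ : V →ₗ[k] W) : Prop :=
  Function.Injective φ ∨ Function.Surjective φ

/-- The zero locus in `ℙ^r` of a polynomial `ℓ`, as a closed subset. -/
def zeroLocus (ℓ : MvPolynomial (Fin (r + 1)) k) : TopologicalSpace.Closeds (PP k r) :=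
  (Proj.basicOpen (gr k r) ℓ).compl

/-- The hyperplane `ℓ = 0` in `ℙ^r`, for a nonzero linear form `ℓ` (as `ℓ` is a prime element,
this closed subscheme is reduced). -/
def Hyperplane (ℓ : MvPolynomial (Fin (r + 1)) k) : Scheme.{u} :=
  (Scheme.IdealSheafData.vanishingIdeal (zeroLocus ℓ)).subscheme

/-- The inclusion of the hyperplane `ℓ = 0` in `ℙ^r`. -/
def Hyperplane.ι (ℓ : MvPolynomial (Fin (r + 1)) k) : Hyperplane ℓ ⟶ PP k r :=
  (Scheme.IdealSheafData.vanishingIdeal (zeroLocus ℓ)).subschemeι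

/-- A curve in `ℙ^r`: a closed subscheme all of whose irreducible components have dimension one,
and which has no embedded points. It may be singular, reducible or non-reduced. -/
structure IsCurve {C : Scheme.{u}} (i : C ⟶ PP k r) : Prop where
  isClosedImmersion : IsClosedImmersion i
  dim_eq_one : ∀ Z ∈ irreducibleComponents C, topologicalKrullDim Z = 1
  associatedPrimes_subset : ∀ U : C.affineOpens,
    associatedPrimes Γ(C, U) Γ(C, U) ⊆ minimalPrimes Γ(C, U)

/-- The closed subscheme `C` of `ℙ^r` has Hilbert polynomial `d x + 1 - g`. For a curve this says
that `C` has degree `d` and (arithmetic) genus `g`. -/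
def HasDegreeGenus {C : Scheme.{u}} (i : C ⟶ PP k r) (d g : ℤ) : Prop :=
  ∀ᶠ m : ℕ in Filter.atTop, (Module.finrank k (H0 i m) : ℤ) = d * m + 1 - g

/-- `C ⊂ ℙ^r` is nondegenerate: no hyperplane contains it as a subscheme. -/
def Nondegenerate {C : Scheme.{u}} (i : C ⟶ PP k r) : Prop :=
  ∀ ℓ ∈ gr k r 1, ℓ ≠ 0 → ¬ ∃ f : C ⟶ Hyperplane ℓ, f ≫ Hyperplane.ι ℓ = i

/-- The hyperplane `ℓ = 0` contains no irreducible component of `C`. -/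
def ContainsNoComponent {C : Scheme.{u}} (i : C ⟶ PP k r) (ℓ : MvPolynomial (Fin (r + 1)) k) :
    Prop :=
  ∀ Z ∈ irreducibleComponents C, ∃ x ∈ Z, i x ∉ zeroLocus ℓ

/-- The restriction map `H⁰(𝒪_H(m)) → H⁰(𝒪_{C ∩ H}(m))`, for `H` the hyperplane `ℓ = 0`. -/
def restriction {C : Scheme.{u}} (i : C ⟶ PP k r) (ℓ : MvPolynomial (Fin (r + 1)) k) (m : ℕ) :
    H0 (Hyperplane.ι ℓ) m →ₗ[k]
      H0 (Limits.pullback.snd i (Hyperplane.ι ℓ) ≫ Hyperplane.ι ℓ) m :=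
  pullback (Hyperplane.ι ℓ) (Limits.pullback.snd i (Hyperplane.ι ℓ)) m

end

end HyperplaneSection

/-! Let `ℓ` be the equation of H. Since C has no embedded points and H contains no component of C,
`ℓ` is a nonzerodivisor on C (`dehom_mem_nonZeroDivisors`), which gives 0 → 𝒪_C(m) → 𝒪_C(m+1) →
𝒪_{C∩H}(m+1) → 0. As C has dimension one, C ∩ H is finite and discrete. From H¹(𝒪_C(2)) = 0 the map
H⁰(𝒪_C(3)) → H⁰(𝒪_{C∩H}(3)) is onto (`pullback_surjective_of_H1`), and on a discrete scheme
surjectivity passes to all higher degrees (`pullback_surjective_succ`). So h⁰(𝒪_C(2+n)) = h⁰(𝒪_C(2))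
+ n h⁰(𝒪_{C∩H}), and the Hilbert polynomial forces h⁰(𝒪_{C∩H}) = d and h⁰(𝒪_C(2)) = 2d + 1 - g
(`finrank_eq_of_hasDegreeGenus`).

Not injective: 4d - 2g < r(r+3) says h⁰(𝒪_C(2)) is less than the dimension of the space of quadratic
forms, so some quadric q ≠ 0 contains C. If the restriction were injective, q would vanish on H, so
q = ℓf. Then the linear form f vanishes on C, and nondegeneracy gives f = 0.

Not surjective: every section of 𝒪_H(2) is a quadratic form (`polySec_hyperplane_surjective`), so
surjectivity would make H⁰(𝒪_C(2)) → H⁰(𝒪_{C∩H}(2)) onto. Then 2d + 1 - g = d + h⁰(𝒪_C(1)) ≥ d + r +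
1 by nondegeneracy, against d < g + r.

Dimension counts with `finrank` need H⁰(𝒪_C(m)) to be finite-dimensional. This is deduced from the
surjectivity of forms onto H⁰(𝒪_C(m)) for large m (`exists_polySec_surjective`). -/

namespace HyperplaneSection

/-! ### Dehomogenization of polynomials on the standard charts. -/

noncomputable section
variable {k : Type u} [Field k] {r : ℕ}

open MvPolynomial in
lemma eval₂_mul_of_isHomogeneous {σ R A : Type*} [CommSemiring R] [CommSemiring A]
    {f : MvPolynomial σ R} {n : ℕ} (hf : f.IsHomogeneous n) (φ : R →+* A) (g : σ → A) (t : A) :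
    eval₂ φ (fun a => t * g a) f = t ^ n * eval₂ φ g f := by
  rw [eval₂_eq, eval₂_eq, Finset.mul_sum]
  refine Finset.sum_congr rfl fun d hd => ?_
  have hd' : d.degree = n := by
    by_contra h
    exact (mem_support_iff.mp hd) (hf.coeff_eq_zero h)
  simp only [mul_pow, Finset.prod_mul_distrib, Finset.prod_pow_eq_pow_sum]
  rw [← hd', Finsupp.degree_apply]
  ring

lemma ΓSpecIso_inv_appLE {X : Scheme.{u}} {R : CommRingCat.{u}} (g : X ⟶ Spec R) (U : X.Opens)
    (φ : R ⟶ Γ(X, U)) (h : U.ι ≫ g = U.toSpecΓ ≫ Spec.map φ) :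
    (Scheme.ΓSpecIso R).inv ≫ g.appLE ⊤ U (le_preimage_top _ _) = φ := by
  have h2 := congrArg (fun f => f.appTop ≫ U.topIso.hom) h
  rw [Scheme.Hom.comp_appTop, Scheme.Hom.comp_appTop, Category.assoc, Category.assoc] at h2
  have h3 : U.toSpecΓ.appTop ≫ U.topIso.hom = (Scheme.ΓSpecIso _).hom := by
    rw [Scheme.Opens.toSpecΓ_appTop, Category.assoc, Iso.inv_hom_id, Category.comp_id]
  have h4 : U.ι.appTop ≫ U.topIso.hom = X.presheaf.map (homOfLE le_top).op := by
    rw [Scheme.Opens.ι_appTop]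
    exact (X.presheaf.map_comp _ _).symm
  rw [h3, h4, Scheme.ΓSpecIso_naturality] at h2
  rw [Iso.inv_comp_eq, ← h2]
  rfl

/-- The algebra map from the ground field to the degree zero part of `k[x]_{x_b}`. -/
def scalarToAway (k : Type u) [Field k] {r : ℕ} (b : Fin (r + 1)) :
    k →+* HomogeneousLocalization.Away (gr k r) (MvPolynomial.X b) :=
  (HomogeneousLocalization.fromZeroRingHom (gr k r) (Submonoid.powers (MvPolynomial.X b))).comp
    (algebraMap k (gr k r 0))

/-- Identifies the `k`-algebra structure coming from the structure morphism with the constants in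
the degree zero part of k[x]_{x_b}. -/
lemma toBase_appLE_stdOpen (b : Fin (r + 1)) :
    (Scheme.ΓSpecIso (.of k)).inv ≫ (toBase k r).appLE ⊤ (stdOpen k b) (le_preimage_top _ _) =
      CommRingCat.ofHom (scalarToAway k b) ≫ Proj.awayToSection (gr k r) (MvPolynomial.X b) := by
  apply ΓSpecIso_inv_appLE
  have h1 : (stdOpen k b).ι ≫ Proj.toSpecZero (gr k r) = (stdOpen k b).toSpecΓ ≫
      Spec.map (CommRingCat.ofHom (HomogeneousLocalization.fromZeroRingHom (gr k r) _) ≫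
        Proj.awayToSection (gr k r) (MvPolynomial.X b)) := by
    have := Proj.awayι_toSpecZero (gr k r) _ (coord_mem k b) zero_lt_one
    rw [← Proj.basicOpenIsoSpec_inv_ι, Category.assoc, Iso.inv_comp_eq,
      Proj.basicOpenIsoSpec_hom, Proj.basicOpenToSpec, Category.assoc, ← Spec.map_comp] at this
    exact this
  let α := CommRingCat.ofHom (algebraMap k (gr k r 0))
  calc (stdOpen k b).ι ≫ toBase k r
      = ((stdOpen k b).ι ≫ Proj.toSpecZero (gr k r)) ≫ Spec.map α := (Category.assoc _ _ _).symm
    _ = _ := congrArg (· ≫ Spec.map α) h1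
    _ = _ := Category.assoc _ _ _
    _ = _ := by rw [← Spec.map_comp]; rfl

/-- Dehomogenization `f ↦ f / x_b ^ deg f`. -/
def dehomAway (k : Type u) [Field k] {r : ℕ} (b : Fin (r + 1)) :
    MvPolynomial (Fin (r + 1)) k →+* HomogeneousLocalization.Away (gr k r) (MvPolynomial.X b) :=
  MvPolynomial.eval₂Hom (scalarToAway k b) fun a =>
    HomogeneousLocalization.Away.mk (gr k r) (coord_mem k b) 1 (MvPolynomial.X a)
      (by simpa using coord_mem k a)

/-- In the localization x_a = x_b · (x_a / x_b), so homogeneity extracts the factor x_b ^ n from f.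
-/
lemma dehomAway_of_mem (b : Fin (r + 1)) {f : MvPolynomial (Fin (r + 1)) k} {n : ℕ}
    (hf : f ∈ gr k r n) :
    dehomAway k b f = HomogeneousLocalization.Away.mk (gr k r) (coord_mem k b) n f
      (by simpa using hf) := by
  apply HomogeneousLocalization.val_injective
  rw [HomogeneousLocalization.Away.val_mk]
  let S := MvPolynomial (Fin (r + 1)) k
  let L := Localization.Away (MvPolynomial.X b : S)
  let p : Submonoid.powers (MvPolynomial.X b : S) := ⟨MvPolynomial.X b ^ 1, 1, rfl⟩
  have h1 : (dehomAway k b f).val = MvPolynomial.eval₂ ((algebraMap S L).comp MvPolynomial.C)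
      (fun a => Localization.mk (MvPolynomial.X a) p) f := by
    change algebraMap _ L (dehomAway k b f) = _
    rw [dehomAway, MvPolynomial.coe_eval₂Hom, MvPolynomial.hom_eval₂]
    congr 1
  have h2 : algebraMap S L f = MvPolynomial.eval₂ ((algebraMap S L).comp MvPolynomial.C)
      (fun a => algebraMap S L (MvPolynomial.X b) * Localization.mk (MvPolynomial.X a) p) f := by
    conv_lhs => rw [← MvPolynomial.eval₂_eta f, MvPolynomial.hom_eval₂]
    congr 1
    funext a
    rw [Localization.mk_eq_mk']
    have := (IsLocalization.mk'_spec' L (MvPolynomial.X a : S) p).symm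
    rwa [show (p : S) = MvPolynomial.X b from pow_one _] at this
  rw [eval₂_mul_of_isHomogeneous hf, ← h1] at h2
  rw [Localization.mk_eq_mk', eq_comm, IsLocalization.mk'_eq_iff_eq_mul]
  erw [h2]
  rw [mul_comm, map_pow]

section

variable {X : Scheme.{u}} (i : X ⟶ PP k r)

/-- Dehomogenization of polynomials with respect to `x_b`, as functions on an open subset of
`X_b`. -/
def dehom (b : Fin (r + 1)) {U : X.Opens} (h : U ≤ chart i b) :
    MvPolynomial (Fin (r + 1)) k →ₐ[k] Fun i U :=
  MvPolynomial.aeval fun a => coord i a b h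

@[simp] lemma dehom_X (a b : Fin (r + 1)) {U : X.Opens} (h : U ≤ chart i b) :
    dehom i b h (MvPolynomial.X a) = coord i a b h := MvPolynomial.aeval_X _ _

lemma dehom_apply (b : Fin (r + 1)) {U : X.Opens} (h : U ≤ chart i b)
    (f : MvPolynomial (Fin (r + 1)) k) :
    dehom i b h f = (i.appLE (stdOpen k b) U h).hom
      ((Proj.awayToSection (gr k r) (MvPolynomial.X b)).hom (dehomAway k b f)) := by
  have : (dehom i b h : MvPolynomial (Fin (r + 1)) k →+* Fun i U) =
      ((i.appLE (stdOpen k b) U h).hom.comp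
        (Proj.awayToSection (gr k r) (MvPolynomial.X b)).hom).comp (dehomAway k b) := by
    apply MvPolynomial.ringHom_ext
    · intro c
      have h1 : dehomAway k b (MvPolynomial.C c) = scalarToAway k b c :=
        MvPolynomial.eval₂Hom_C _ _ _
      have h2 : dehom i b h (MvPolynomial.C c) = algebraMap k (Fun i U) c :=
        MvPolynomial.aeval_C _ _
      change dehom i b h (MvPolynomial.C c) = (i.appLE (stdOpen k b) U h).hom
        ((Proj.awayToSection (gr k r) (MvPolynomial.X b)).hom (dehomAway k b (MvPolynomial.C c)))
      rw [h1, h2]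
      have h3 := congrArg (fun φ => (φ ≫ i.appLE (stdOpen k b) U h).hom c)
        (toBase_appLE_stdOpen (k := k) b)
      simp only [Category.assoc] at h3
      rw [Scheme.Hom.appLE_comp_appLE] at h3
      exact h3
    · intro a
      have h1 : dehomAway k b (MvPolynomial.X a) = _ := MvPolynomial.eval₂Hom_X' _ _ _
      change dehom i b h (MvPolynomial.X a) = (i.appLE (stdOpen k b) U h).hom
        ((Proj.awayToSection (gr k r) (MvPolynomial.X b)).hom (dehomAway k b (MvPolynomial.X a)))
      rw [h1, dehom_X]
      rfl
  exact congrArg (fun φ => φ f) this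

end

end

/-! ### Charts: nonvanishing loci, transition functions, functions as fractions. -/

noncomputable section
variable {k : Type u} [Field k] {r : ℕ}

lemma basicOpen_awayToSection (b : Fin (r + 1)) {F : MvPolynomial (Fin (r + 1)) k}
    (hF : F ∈ gr k r 1) :
    (PP k r).basicOpen ((Proj.awayToSection (gr k r) (MvPolynomial.X b)).hom (dehomAway k b F)) =
      stdOpen k b ⊓ Proj.basicOpen (gr k r) F := by
  have h1 := Proj.awayι_preimage_basicOpen (gr k r) (coord_mem k b) zero_lt_one hF zero_lt_one
  have h2 : Proj.basicOpenToSpec (gr k r) (MvPolynomial.X b) ≫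
      Proj.awayι (gr k r) _ (coord_mem k b) zero_lt_one = (stdOpen k b).ι := by
    rw [← Proj.basicOpenIsoSpec_inv_ι, ← Proj.basicOpenIsoSpec_hom _ _ (coord_mem k b) zero_lt_one,
      Iso.hom_inv_id_assoc]
    rfl
  have h3 : HomogeneousLocalization.Away.isLocalizationElem (coord_mem k b) hF =
      dehomAway k b F := by
    rw [dehomAway_of_mem b hF]
    simp [HomogeneousLocalization.Away.isLocalizationElem]
  have h4 : (stdOpen k b).ι ⁻¹ᵁ Proj.basicOpen (gr k r) F = (stdOpen k b).ι ⁻¹ᵁ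
      (PP k r).basicOpen
        ((Proj.awayToSection (gr k r) (MvPolynomial.X b)).hom (dehomAway k b F)) := by
    refine Eq.trans ?_ (Scheme.Opens.toSpecΓ_preimage_basicOpen (stdOpen k b)
      ((Proj.awayToSection (gr k r) (MvPolynomial.X b)).hom (dehomAway k b F)))
    rw [← h2]
    refine (congrArg (fun V => Proj.basicOpenToSpec (gr k r) (MvPolynomial.X b) ⁻¹ᵁ V) h1).trans ?_
    rw [h3]
    rfl
  have h5 := congrArg (fun V => (stdOpen k b).ι ''ᵁ V) h4
  simp only [Scheme.Hom.image_preimage_eq_opensRange_inf, Scheme.Opens.opensRange_ι] at h5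
  rw [h5]
  exact (inf_eq_right.mpr (Scheme.basicOpen_le _ _)).symm

section

variable {X : Scheme.{u}} (i : X ⟶ PP k r)

lemma basicOpen_dehom (b : Fin (r + 1)) {U : X.Opens} (h : U ≤ chart i b)
    {F : MvPolynomial (Fin (r + 1)) k} (hF : F ∈ gr k r 1) :
    X.basicOpen (U := U) (dehom i b h F) = U ⊓ i ⁻¹ᵁ Proj.basicOpen (gr k r) F := by
  rw [dehom_apply]
  refine (Scheme.basicOpen_appLE _ _ _ _ _).trans ?_
  erw [basicOpen_awayToSection b hF]
  rw [Scheme.Hom.preimage_inf, ← inf_assoc, inf_eq_left.mpr h]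

lemma basicOpen_coord (a b : Fin (r + 1)) {U : X.Opens} (h : U ≤ chart i b) :
    X.basicOpen (U := U) (coord i a b h) = U ⊓ chart i a := by
  rw [← dehom_X, basicOpen_dehom i b h (coord_mem k a)]
  rfl

lemma iSup_stdOpen : ⨆ a, stdOpen k (r := r) a = ⊤ := by
  refine Proj.iSup_basicOpen_eq_top' (gr k r) _ (fun a => ⟨1, coord_mem k a⟩) ?_
  rw [eq_top_iff]
  rintro f -
  induction f using MvPolynomial.induction_on with
  | C c =>
    let c' : gr k r 0 := ⟨MvPolynomial.C c, MvPolynomial.isHomogeneous_C _ c⟩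
    exact Subalgebra.algebraMap_mem (Algebra.adjoin (gr k r 0)
      (Set.range fun a : Fin (r + 1) => (MvPolynomial.X a : MvPolynomial (Fin (r + 1)) k))) c'
  | add p q hp hq => exact add_mem hp hq
  | mul_X p a hp => exact mul_mem hp (Algebra.subset_adjoin ⟨a, rfl⟩)

lemma iSup_chart : ⨆ a, chart i a = ⊤ := by
  rw [← Scheme.Hom.preimage_iSup, iSup_stdOpen]
  rfl

lemma dehom_eq_awayMap (b c : Fin (r + 1)) {U : X.Opens} (hb : U ≤ chart i b)
    {x : MvPolynomial (Fin (r + 1)) k} (hx : x = MvPolynomial.X b * MvPolynomial.X c)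
    (hU : U ≤ i ⁻¹ᵁ Proj.basicOpen (gr k r) x) (f : MvPolynomial (Fin (r + 1)) k) :
    dehom i b hb f = (i.appLE _ U hU).hom ((Proj.awayToSection (gr k r) x).hom
      (HomogeneousLocalization.awayMap (gr k r) (coord_mem k c) hx (dehomAway k b f))) := by
  have h1 := congrArg (fun φ => (φ ≫ i.appLE _ U hU).hom (dehomAway k b f))
    (Proj.awayMap_awayToSection (gr k r) (coord_mem k c) hx)
  simp only [Category.assoc, Scheme.Hom.map_appLE] at h1
  rw [dehom_apply]
  exact h1.symm

/-- Both sides come from the degree zero part of k[x]_{x_a x_b}, where this is an identity of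
fractions. It is the transition rule that makes a form of degree n a section of 𝒪(n). -/
lemma dehom_eq_coord_pow_mul {a b : Fin (r + 1)} {U : X.Opens} (ha : U ≤ chart i a)
    (hb : U ≤ chart i b) {f : MvPolynomial (Fin (r + 1)) k} {n : ℕ} (hf : f ∈ gr k r n) :
    dehom i b hb f = coord i a b hb ^ n * dehom i a ha f := by
  have hU : U ≤ i ⁻¹ᵁ Proj.basicOpen (gr k r) (MvPolynomial.X a * MvPolynomial.X b) := by
    rw [Proj.basicOpen_mul]
    exact le_inf ha hb
  rw [← dehom_X, dehom_eq_awayMap i b a hb (mul_comm _ _) hU,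
    dehom_eq_awayMap i b a hb (mul_comm _ _) hU, dehom_eq_awayMap i a b ha rfl hU]
  erw [← map_pow, ← map_mul, ← map_pow, ← map_mul]
  congr 2
  rw [dehomAway_of_mem _ hf, dehomAway_of_mem _ hf, dehomAway_of_mem _ (coord_mem k a)]
  apply HomogeneousLocalization.val_injective
  rw [HomogeneousLocalization.val_mul, HomogeneousLocalization.val_pow,
    HomogeneousLocalization.awayMap_mk, HomogeneousLocalization.awayMap_mk,
    HomogeneousLocalization.awayMap_mk]
  simp only [HomogeneousLocalization.Away.val_mk, Localization.mk_pow, Localization.mk_mul]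
  rw [Localization.mk_eq_mk_iff, Localization.r_iff_exists]
  refine ⟨1, ?_⟩
  simp
  ring

lemma coord_self (b : Fin (r + 1)) {U : X.Opens} (h : U ≤ chart i b) : coord i b b h = 1 := by
  rw [← dehom_X, dehom_apply, dehomAway_of_mem _ (coord_mem k b)]
  have : HomogeneousLocalization.Away.mk (gr k r) (coord_mem k b) 1 (MvPolynomial.X b)
      (by simpa using coord_mem k b) = 1 := by
    apply HomogeneousLocalization.val_injective
    rw [HomogeneousLocalization.Away.val_mk, HomogeneousLocalization.val_one]
    rw [Localization.mk_eq_mk', IsLocalization.mk'_eq_iff_eq_mul]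
    simp
  rw [this]
  exact (congrArg _ (map_one (Proj.awayToSection (gr k r) (MvPolynomial.X b)).hom)).trans
    (map_one (i.appLE (stdOpen k b) U h).hom)

lemma coord_mul_coord {a b c : Fin (r + 1)} {U : X.Opens} (hb : U ≤ chart i b)
    (hc : U ≤ chart i c) : coord i b c hc * coord i a b hb = coord i a c hc := by
  rw [← dehom_X i a c, dehom_eq_coord_pow_mul i hb hc (coord_mem k a), pow_one, dehom_X]

lemma res_dehom {b : Fin (r + 1)} {U V : X.Opens} (h : U ≤ chart i b) (h' : V ≤ U)
    (f : MvPolynomial (Fin (r + 1)) k) :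
    Fun.res i h' (dehom i b h f) = dehom i b (h'.trans h) f := by
  have : (Fun.res i h').comp (dehom i b h) = dehom i b (h'.trans h) := by
    ext a
    simp [Fun.res_coord]
  exact congrArg (fun φ => φ f) this

lemma pull_dehom {Y : Scheme.{u}} (φ : Y ⟶ X) {b : Fin (r + 1)} {U : X.Opens} {V : Y.Opens}
    (h : U ≤ chart i b) (h' : V ≤ φ ⁻¹ᵁ U) (h'' : V ≤ chart (φ ≫ i) b)
    (f : MvPolynomial (Fin (r + 1)) k) :
    Fun.pull i φ h' (dehom i b h f) = dehom (φ ≫ i) b h'' f := by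
  have : (Fun.pull i φ h').comp (dehom i b h) = dehom (φ ≫ i) b h'' := by
    ext a
    simp [Fun.pull_coord i φ a b h h' h'']
  exact congrArg (fun φ => φ f) this

lemma isAffineOpen_stdOpen (b : Fin (r + 1)) : IsAffineOpen (stdOpen k b) :=
  Proj.isAffineOpen_basicOpen _ _ (coord_mem k b) zero_lt_one

lemma isAffineOpen_chart [IsAffineHom i] (b : Fin (r + 1)) : IsAffineOpen (chart i b) :=
  (isAffineOpen_stdOpen b).preimage i

lemma isAffineOpen_chart_inf [IsAffineHom i] {U : X.Opens} {b : Fin (r + 1)} (hU : IsAffineOpen U)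
    (h : U ≤ chart i b) (a : Fin (r + 1)) : IsAffineOpen (U ⊓ chart i a) := by
  rw [← basicOpen_coord i a b h]
  exact hU.basicOpen _

lemma awayToSection_bijective (b : Fin (r + 1)) :
    Function.Bijective (Proj.awayToSection (gr k r) (MvPolynomial.X b)).hom := by
  have h : IsIso (Proj.awayToSection (gr k r) (MvPolynomial.X b)) := by
    rw [← Proj.basicOpenIsoAway_hom (gr k r) _ (coord_mem k b) zero_lt_one]
    infer_instance
  exact ConcreteCategory.bijective_of_isIso (Proj.awayToSection (gr k r) (MvPolynomial.X b))

/-- A closed immersion is surjective on functions over the affine open D₊(x_b), where functions are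
fractions f / x_b ^ n. -/
lemma exists_eq_dehom [IsClosedImmersion i] (b : Fin (r + 1)) (s : Fun i (chart i b)) :
    ∃ n, ∃ f ∈ gr k r n, dehom i b le_rfl f = s := by
  obtain ⟨t, ht⟩ := Scheme.Hom.app_surjective i _ (isAffineOpen_stdOpen b) s
  obtain ⟨z, hz⟩ := (awayToSection_bijective b).2 t
  obtain ⟨n, f, hf, rfl⟩ := HomogeneousLocalization.Away.mk_surjective (gr k r) (coord_mem k b) z
  have hf' : f ∈ gr k r n := by simpa using hf
  refine ⟨n, f, hf', ?_⟩
  rw [dehom_apply, dehomAway_of_mem b hf']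
  erw [hz]
  rw [Scheme.Hom.appLE_eq_app]
  exact ht

lemma dehom_surjective [IsClosedImmersion i] (b : Fin (r + 1)) :
    Function.Surjective (dehom i b (le_refl (chart i b))) := fun s =>
  let ⟨_, f, _, h⟩ := exists_eq_dehom i b s
  ⟨f, h⟩

lemma eq_zero_of_awayToSection_dehomAway {b : Fin (r + 1)} {f : MvPolynomial (Fin (r + 1)) k}
    {n : ℕ} (hf : f ∈ gr k r n) (h : dehomAway k b f = 0) : f = 0 := by
  rw [dehomAway_of_mem b hf, HomogeneousLocalization.ext_iff_val,
    HomogeneousLocalization.Away.val_mk, HomogeneousLocalization.val_zero,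
    Localization.mk_eq_mk', IsLocalization.mk'_eq_zero_iff] at h
  obtain ⟨⟨_, m, rfl⟩, hm⟩ := h
  simpa using hm

end

end

/-! ### Linear forms and the ideal of a hyperplane. -/

noncomputable section
variable {k : Type u} [Field k] {r : ℕ}

section LinearForm

open MvPolynomial

variable {σ : Type*} {ℓ : MvPolynomial σ k}

lemma eq_sum_coeff_smul_X [Fintype σ] (hℓ : ℓ.IsHomogeneous 1) :
    ∑ b, coeff (Finsupp.single b 1) ℓ • X b = ℓ := by
  classical
  obtain ⟨a, ha⟩ : ∃ a : σ → k, ∑ b, a b • X b = ℓ := by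
    have h : ℓ ∈ Submodule.span k (Set.range (X : σ → MvPolynomial σ k)) := by
      rw [← homogeneousSubmodule_one_eq_span_X]
      exact hℓ
    exact (Submodule.mem_span_range_iff_exists_fun k).mp h
  have hac : ∀ c, coeff (Finsupp.single c 1) ℓ = a c := fun c => by
    rw [← ha, coeff_sum]
    simp [coeff_X, Finsupp.single_left_inj]
  simpa only [hac] using ha

lemma exists_coeff_single_ne_zero [Fintype σ] (hℓ : ℓ.IsHomogeneous 1) (h0 : ℓ ≠ 0) :
    ∃ c, coeff (Finsupp.single c 1) ℓ ≠ 0 := by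
  by_contra! h
  exact h0 (by simpa [h] using (eq_sum_coeff_smul_X hℓ).symm)

open Classical in
/-- The endomorphism of the polynomial ring that eliminates the variable `x_c` by means of the
linear form `ℓ`. -/
def elim (ℓ : MvPolynomial σ k) (c : σ) : MvPolynomial σ k →ₐ[k] MvPolynomial σ k :=
  aeval fun b => if b = c then X c - C (coeff (Finsupp.single c 1) ℓ)⁻¹ * ℓ else X b

lemma elim_X_of_ne {b c : σ} (h : b ≠ c) : elim ℓ c (X b) = X b := by
  simp [elim, h]

lemma sub_elim_mem (c : σ) (f : MvPolynomial σ k) : f - elim ℓ c f ∈ Ideal.span {ℓ} := by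
  rw [← Ideal.Quotient.mk_eq_mk_iff_sub_mem]
  have : Ideal.Quotient.mkₐ k (Ideal.span {ℓ}) =
      (Ideal.Quotient.mkₐ k (Ideal.span {ℓ})).comp (elim ℓ c) := by
    ext b
    by_cases h : b = c
    · subst h
      simp only [AlgHom.comp_apply, elim, aeval_X, if_true]
      refine Ideal.Quotient.mk_eq_mk_iff_sub_mem _ _ |>.mpr ?_
      rw [sub_sub_cancel]
      exact Ideal.mul_mem_left _ _ (Ideal.mem_span_singleton_self ℓ)
    · rw [AlgHom.comp_apply, elim_X_of_ne h]
  exact congrArg (fun φ => φ f) this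

lemma isHomogeneous_elim (hℓ : ℓ.IsHomogeneous 1) (c : σ) {f : MvPolynomial σ k} {n : ℕ}
    (hf : f.IsHomogeneous n) : (elim ℓ c f).IsHomogeneous n := by
  classical
  have := hf.aeval (n := 1) (S := k)
    (fun b => if b = c then X c - C (coeff (Finsupp.single c 1) ℓ)⁻¹ * ℓ else X b) (fun b => by
      split_ifs
      · exact (isHomogeneous_X k c).sub (by simpa using (isHomogeneous_C σ _).mul hℓ)
      · exact isHomogeneous_X k b)
  simpa [elim] using this

lemma elim_self [Fintype σ] (hℓ : ℓ.IsHomogeneous 1) {c : σ}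
    (hc : coeff (Finsupp.single c 1) ℓ ≠ 0) : elim ℓ c ℓ = 0 := by
  classical
  set a : σ → k := fun b => coeff (Finsupp.single b 1) ℓ
  have ha : ∑ b, a b • X b = ℓ := eq_sum_coeff_smul_X hℓ
  have h1 : elim ℓ c ℓ = ∑ b, (a b • X b - if b = c then ℓ else 0) := by
    conv_lhs => rw [← ha, map_sum, ha]
    refine Finset.sum_congr rfl fun b _ => ?_
    by_cases h : b = c
    · subst h
      rw [map_smul, if_pos rfl]
      simp only [elim, aeval_X, if_true, smul_sub, C_mul', smul_smul]
      rw [mul_inv_cancel₀ hc, one_smul]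
    · rw [map_smul, elim_X_of_ne h, if_neg h, sub_zero]
  rw [h1, Finset.sum_sub_distrib, ha]
  simp

/-- The elimination is the identity modulo `ℓ` and kills `ℓ`. Divisibility by `ℓ` thus becomes
vanishing in a domain, which shows in particular that `ℓ` is prime. -/
lemma elim_eq_zero_iff [Fintype σ] (hℓ : ℓ.IsHomogeneous 1) {c : σ}
    (hc : coeff (Finsupp.single c 1) ℓ ≠ 0) (f : MvPolynomial σ k) :
    elim ℓ c f = 0 ↔ ℓ ∣ f := by
  constructor
  · intro h
    simpa [h, Ideal.mem_span_singleton] using sub_elim_mem (ℓ := ℓ) c f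
  · rintro ⟨g, rfl⟩
    rw [map_mul, elim_self hℓ hc, zero_mul]

lemma prime_of_isHomogeneous_one [Fintype σ] (hℓ : ℓ.IsHomogeneous 1) (h0 : ℓ ≠ 0) :
    Prime ℓ := by
  obtain ⟨c, hc⟩ := exists_coeff_single_ne_zero hℓ h0
  refine ⟨h0, fun h => ?_, fun f g h => ?_⟩
  · have h1 := (elim_eq_zero_iff hℓ hc 1).mpr h.dvd
    rw [map_one] at h1
    exact one_ne_zero h1
  · simpa [← elim_eq_zero_iff hℓ hc] using h

lemma mem_of_forall_X_mem {I : Ideal (MvPolynomial σ k)} (hI : ∀ a, X a ∈ I)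
    {f : MvPolynomial σ k} {n : ℕ} (hf : f.IsHomogeneous (n + 1)) : f ∈ I := by
  have h : f ∈ Ideal.span (X '' Set.univ) := by
    rw [mem_ideal_span_X_image]
    intro d hd
    have hd' : d.degree = n + 1 := by
      by_contra h
      exact (mem_support_iff.mp hd) (hf.coeff_eq_zero h)
    by_contra! h
    have : d = 0 := by ext a; simpa using h a
    simp [this] at hd'
  refine (Ideal.span_le.mpr ?_) h
  rintro _ ⟨a, -, rfl⟩
  exact hI a

end LinearForm

lemma dehomAway_X_self (b : Fin (r + 1)) : dehomAway k b (MvPolynomial.X b) = 1 := by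
  rw [dehomAway_of_mem b (coord_mem k b)]
  apply HomogeneousLocalization.val_injective
  rw [HomogeneousLocalization.Away.val_mk, HomogeneousLocalization.val_one,
    Localization.mk_eq_mk', IsLocalization.mk'_eq_iff_eq_mul]
  simp

lemma X_pow_mul_mem (b : Fin (r + 1)) {n : ℕ} (m : ℕ) {f : MvPolynomial (Fin (r + 1)) k}
    (hf : f ∈ gr k r n) : MvPolynomial.X b ^ m * f ∈ gr k r (m + n) :=
  (MvPolynomial.isHomogeneous_X_pow b m).mul hf

lemma X_pow_mul_eq_of_dehomAway_eq (b : Fin (r + 1)) {n m : ℕ}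
    {f g : MvPolynomial (Fin (r + 1)) k} (hf : f ∈ gr k r n) (hg : g ∈ gr k r m)
    (h : dehomAway k b f = dehomAway k b g) :
    MvPolynomial.X b ^ m * f = MvPolynomial.X b ^ n * g := by
  rw [← sub_eq_zero]
  refine eq_zero_of_awayToSection_dehomAway (b := b) (n := m + n)
    (sub_mem (X_pow_mul_mem b m hf) (add_comm n m ▸ X_pow_mul_mem b n hg)) ?_
  simp [dehomAway_X_self, h]

/-- The section of the structure sheaf of `ℙ^r` over `x_b ≠ 0` defined by a polynomial. -/
def stdSection (k : Type u) [Field k] {r : ℕ} (b : Fin (r + 1)) :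
    MvPolynomial (Fin (r + 1)) k →+* Γ(PP k r, stdOpen k b) :=
  (Proj.awayToSection (gr k r) (MvPolynomial.X b)).hom.comp (dehomAway k b)

lemma stdSection_eq_iff (b : Fin (r + 1)) (f g : MvPolynomial (Fin (r + 1)) k) :
    stdSection k b f = stdSection k b g ↔ dehomAway k b f = dehomAway k b g :=
  (awayToSection_bijective b).1.eq_iff

lemma stdSection_apply (b : Fin (r + 1)) (f : MvPolynomial (Fin (r + 1)) k) :
    stdSection k b f =
      (Proj.awayToSection (gr k r) (MvPolynomial.X b)).hom (dehomAway k b f) := rfl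

lemma exists_eq_stdSection (b : Fin (r + 1)) (s : Γ(PP k r, stdOpen k b)) :
    ∃ n, ∃ f ∈ gr k r n, stdSection k b f = s := by
  obtain ⟨z, hz⟩ := (awayToSection_bijective b).2 s
  obtain ⟨n, f, hf, rfl⟩ := HomogeneousLocalization.Away.mk_surjective (gr k r) (coord_mem k b) z
  have hf' : f ∈ gr k r n := by simpa using hf
  refine ⟨n, f, hf', ?_⟩
  rw [← hz, stdSection_apply, dehomAway_of_mem b hf']

lemma dehom_eq_appLE_stdSection {X : Scheme.{u}} (i : X ⟶ PP k r) (b : Fin (r + 1)) {U : X.Opens}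
    (h : U ≤ chart i b) (f : MvPolynomial (Fin (r + 1)) k) :
    dehom i b h f = (i.appLE (stdOpen k b) U h).hom (stdSection k b f) :=
  dehom_apply i b h f

variable {ℓ : MvPolynomial (Fin (r + 1)) k}

/-- Clearing denominators gives a divisibility by the prime `ℓ` in the polynomial ring. The
alternative `ℓ ∣ X b` is the case where H misses the chart D₊(x_b). -/
lemma dvd_or_dvd_of_stdSection_pow_mem (hℓ : ℓ ∈ gr k r 1) (h0 : ℓ ≠ 0) (b : Fin (r + 1))
    {n N : ℕ} {f : MvPolynomial (Fin (r + 1)) k} (hf : f ∈ gr k r n)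
    (h : stdSection k b f ^ N ∈ Ideal.span {stdSection k b ℓ}) :
    ℓ ∣ f ∨ ℓ ∣ MvPolynomial.X b := by
  have hp := prime_of_isHomogeneous_one hℓ h0
  obtain ⟨t, ht⟩ := Ideal.mem_span_singleton.mp h
  obtain ⟨m, g, hg, rfl⟩ := exists_eq_stdSection b t
  rw [← map_pow, ← map_mul, stdSection_eq_iff] at ht
  have h1 := X_pow_mul_eq_of_dehomAway_eq b (MvPolynomial.IsHomogeneous.pow hf N)
    (MvPolynomial.IsHomogeneous.mul hℓ hg) ht
  have h2 : ℓ ∣ MvPolynomial.X b ^ (1 + m) * f ^ N := by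
    rw [h1]
    exact (dvd_mul_right _ _).mul_left _
  rcases hp.dvd_or_dvd h2 with h3 | h3
  · exact Or.inr (hp.dvd_of_dvd_pow h3)
  · exact Or.inl (hp.dvd_of_dvd_pow h3)

lemma stdSection_mem_span_of_dvd {b : Fin (r + 1)} {f : MvPolynomial (Fin (r + 1)) k}
    (h : ℓ ∣ f ∨ ℓ ∣ MvPolynomial.X b) : stdSection k b f ∈ Ideal.span {stdSection k b ℓ} := by
  rw [Ideal.mem_span_singleton]
  rcases h with h | h
  · exact map_dvd _ h
  · refine (map_dvd (stdSection k b) h).trans (isUnit_iff_dvd_one.mp ?_ |>.trans (one_dvd _))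
    rw [stdSection_apply, dehomAway_X_self]
    exact isUnit_one.map _

/-- The reduced structure is given by the radical of (ℓ / x_b), and this ideal is already radical
because `ℓ` is prime. -/
lemma vanishingIdeal_zeroLocus_ideal (hℓ : ℓ ∈ gr k r 1) (h0 : ℓ ≠ 0) (b : Fin (r + 1)) :
    (Scheme.IdealSheafData.vanishingIdeal (zeroLocus ℓ)).ideal ⟨stdOpen k b, isAffineOpen_stdOpen b⟩
      = Ideal.span {stdSection k b ℓ} := by
  have hU := isAffineOpen_stdOpen (k := k) b
  have h1 : hU.fromSpec ⁻¹' (zeroLocus ℓ : Set (PP k r)) =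
      PrimeSpectrum.zeroLocus {stdSection k b ℓ} := by
    have h2 := hU.fromSpec_preimage_basicOpen (stdSection k b ℓ)
    rw [show (PP k r).basicOpen (stdSection k b ℓ) = _ from basicOpen_awayToSection b hℓ,
      Scheme.Hom.preimage_inf, hU.fromSpec_preimage_self, top_inf_eq] at h2
    rw [← compl_compl (PrimeSpectrum.zeroLocus _), ← PrimeSpectrum.basicOpen_eq_zeroLocus_compl,
      ← h2]
    rfl
  rw [Scheme.IdealSheafData.vanishingIdeal_ideal]
  refine (congrArg PrimeSpectrum.vanishingIdeal h1).trans ?_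
  rw [← PrimeSpectrum.zeroLocus_span, PrimeSpectrum.vanishingIdeal_zeroLocus_eq_radical]
  refine le_antisymm (fun s hs => ?_) Ideal.le_radical
  obtain ⟨N, hN⟩ := hs
  obtain ⟨n, f, hf, rfl⟩ := exists_eq_stdSection b s
  exact stdSection_mem_span_of_dvd (dvd_or_dvd_of_stdSection_pow_mem hℓ h0 b hf hN)

instance : IsClosedImmersion (Hyperplane.ι ℓ) :=
  inferInstanceAs (IsClosedImmersion (Scheme.IdealSheafData.subschemeι _))

lemma dvd_or_dvd_of_dehom_eq_zero (hℓ : ℓ ∈ gr k r 1) (h0 : ℓ ≠ 0) (b : Fin (r + 1))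
    {n : ℕ} {f : MvPolynomial (Fin (r + 1)) k} (hf : f ∈ gr k r n)
    (h : dehom (Hyperplane.ι ℓ) b le_rfl f = 0) : ℓ ∣ f ∨ ℓ ∣ MvPolynomial.X b := by
  refine dvd_or_dvd_of_stdSection_pow_mem hℓ h0 b hf (N := 1) ?_
  rw [pow_one, ← vanishingIdeal_zeroLocus_ideal hℓ h0, ← Scheme.IdealSheafData.ker_subschemeι_app]
  rw [dehom_eq_appLE_stdSection, Scheme.Hom.appLE_eq_app] at h
  exact h

lemma dehom_eq_zero_of_dvd (hℓ : ℓ ∈ gr k r 1) (h0 : ℓ ≠ 0) (b : Fin (r + 1)) {U : (Hyperplane ℓ).Opens}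
    (hU : U ≤ chart (Hyperplane.ι ℓ) b)
    {f : MvPolynomial (Fin (r + 1)) k} (h : ℓ ∣ f ∨ ℓ ∣ MvPolynomial.X b) :
    dehom (Hyperplane.ι ℓ) b hU f = 0 := by
  have h1 := stdSection_mem_span_of_dvd h
  rw [← vanishingIdeal_zeroLocus_ideal hℓ h0, ← Scheme.IdealSheafData.ker_subschemeι_app] at h1
  rw [← res_dehom (Hyperplane.ι ℓ) le_rfl hU, dehom_eq_appLE_stdSection, Scheme.Hom.appLE_eq_app]
  exact (congrArg _ h1).trans (map_zero _)

lemma exists_fac_hyperplane (hℓ : ℓ ∈ gr k r 1) (h0 : ℓ ≠ 0) {Y : Scheme.{u}} (y : Y ⟶ PP k r)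
    [QuasiCompact y] (h : ∀ b, dehom y b le_rfl ℓ = 0) :
    ∃ f : Y ⟶ Hyperplane ℓ, f ≫ Hyperplane.ι ℓ = y := by
  have hle : (Hyperplane.ι ℓ).ker ≤ y.ker := by
    refine (Scheme.IdealSheafData.ker_subschemeι _).trans_le ?_
    refine Scheme.IdealSheafData.le_of_iSup_eq_top
      (fun b : Fin (r + 1) => ⟨stdOpen k b, isAffineOpen_stdOpen b⟩) iSup_stdOpen fun b => ?_
    rw [vanishingIdeal_zeroLocus_ideal hℓ h0, Scheme.Hom.ker_apply,
      Ideal.span_singleton_le_iff_mem, RingHom.mem_ker]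
    have := h b
    rw [dehom_eq_appLE_stdSection, Scheme.Hom.appLE_eq_app] at this
    exact this
  exact ⟨IsClosedImmersion.lift _ _ hle, IsClosedImmersion.lift_fac _ _ hle⟩

/-- If `ℓ ∤ f`, then `ℓ` divides every variable, so the ideal (ℓ) contains all forms of positive
degree, including f. -/
lemma dvd_of_forall_dehom_eq_zero (hℓ : ℓ ∈ gr k r 1) (h0 : ℓ ≠ 0) {n : ℕ}
    {f : MvPolynomial (Fin (r + 1)) k} (hf : f ∈ gr k r (n + 1))
    (h : ∀ b, dehom (Hyperplane.ι ℓ) b le_rfl f = 0) : ℓ ∣ f := by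
  by_contra hf'
  refine hf' (Ideal.mem_span_singleton.mp (mem_of_forall_X_mem (fun b => ?_) hf))
  exact Ideal.mem_span_singleton.mpr
    ((dvd_or_dvd_of_dehom_eq_zero hℓ h0 b hf (h b)).resolve_left hf')

end

/-! ### Sections of 𝒪(m): gluing, forms as sections, multiplication, pullback. -/

noncomputable section
variable {k : Type u} [Field k] {r : ℕ} {X : Scheme.{u}} (i : X ⟶ PP k r)

@[simp] lemma Fun.res_self {U : X.Opens} (h : U ≤ U) (s : Fun i U) : Fun.res i h s = s := by
  change (X.presheaf.map (𝟙 _)).hom s = s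
  rw [X.presheaf.map_id]
  rfl

lemma Fun.eq_of_res {ι : Type*} {U : X.Opens} (V : ι → X.Opens) (hV : ∀ j, V j ≤ U)
    (hU : U ≤ ⨆ j, V j) {s t : Fun i U} (h : ∀ j, Fun.res i (hV j) s = Fun.res i (hV j) t) :
    s = t :=
  TopCat.Sheaf.eq_of_locally_eq' X.sheaf V U (fun j => homOfLE (hV j)) hU s t h

lemma Fun.exists_glue {ι : Type*} {U : X.Opens} (V : ι → X.Opens) (hV : ∀ j, V j ≤ U)
    (hU : U ≤ ⨆ j, V j) (s : ∀ j, Fun i (V j))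
    (h : ∀ j j', Fun.res i (inf_le_left : V j ⊓ V j' ≤ V j) (s j) =
      Fun.res i (inf_le_right : V j ⊓ V j' ≤ V j') (s j')) :
    ∃ t : Fun i U, ∀ j, Fun.res i (hV j) t = s j :=
  (TopCat.Sheaf.existsUnique_gluing' X.sheaf V U (fun j => homOfLE (hV j)) hU s fun j j' => h j j').exists

variable {i} {m : ℕ}

lemma Sec.ext {U : X.Opens} {s t : Sec i m U} (h : ∀ a, s.1 a = t.1 a) : s = t :=
  Subtype.ext (funext h)

lemma Sec.res_apply {U V : X.Opens} (h : V ≤ U) (s : Sec i m U) (a : Fin (r + 1)) :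
    (Sec.res i m h s).1 a = Fun.res i (inf_le_inf_right (chart i a) h) (s.1 a) := rfl

lemma Sec.res_res {U V W : X.Opens} (h : V ≤ U) (h' : W ≤ V) (s : Sec i m U) :
    Sec.res i m h' (Sec.res i m h s) = Sec.res i m (h'.trans h) s :=
  Sec.ext fun a => by simp only [Sec.res_apply, Fun.res_res]

lemma Sec.res_apply_eq {U V : X.Opens} (s : Sec i m U) {a b : Fin (r + 1)}
    (ha : V ≤ U ⊓ chart i a) (hb : V ≤ U ⊓ chart i b) :
    Fun.res i hb (s.1 b) = coord i a b (hb.trans inf_le_right) ^ m * Fun.res i ha (s.1 a) := by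
  have h1 := congrArg (Fun.res i (le_inf (ha.trans inf_le_right) hb)) (s.2 a b)
  simpa only [map_mul, map_pow, Fun.res_res, Fun.res_coord] using h1

lemma Sec.ext_of_le {U : X.Opens} {c : Fin (r + 1)} (hU : U ≤ chart i c) {s t : Sec i m U}
    (h : s.1 c = t.1 c) : s = t := by
  refine Sec.ext fun a => ?_
  have h1 := Sec.res_apply_eq s (V := U ⊓ chart i a) (a := c) (b := a)
    (le_inf inf_le_left (inf_le_left.trans hU)) le_rfl
  have h2 := Sec.res_apply_eq t (V := U ⊓ chart i a) (a := c) (b := a)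
    (le_inf inf_le_left (inf_le_left.trans hU)) le_rfl
  rw [Fun.res_self] at h1 h2
  rw [h1, h2, h]

variable (i m) in
/-- The trivialization of `𝒪(m)` on an open subset of `X_c`, as a map from functions. -/
def Sec.ofFun {U : X.Opens} (c : Fin (r + 1)) (s : Fun i U) : Sec i m U :=
  ⟨fun b => coord i c b inf_le_right ^ m * Fun.res i inf_le_left s, fun a b => by
    rw [map_mul, map_mul, map_pow, map_pow, Fun.res_coord, Fun.res_coord, Fun.res_res,
      Fun.res_res, ← mul_assoc, ← mul_pow, coord_mul_coord i]⟩

lemma Sec.ofFun_apply_self {U : X.Opens} (c : Fin (r + 1)) (s : Fun i U) :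
    (Sec.ofFun i m c s).1 c = Fun.res i inf_le_left s := by
  simp [Sec.ofFun, coord_self]

lemma Sec.eq_of_res {ι : Type*} {U : X.Opens} (V : ι → X.Opens) (hV : ∀ j, V j ≤ U)
    (hU : U ≤ ⨆ j, V j) {s t : Sec i m U}
    (h : ∀ j, Sec.res i m (hV j) s = Sec.res i m (hV j) t) : s = t := by
  refine Sec.ext fun a => Fun.eq_of_res i (fun j => V j ⊓ chart i a)
    (fun j => inf_le_inf_right _ (hV j)) ?_ fun j => congrArg (fun s => s.1 a) (h j)
  rw [← iSup_inf_eq]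
  exact inf_le_inf_right _ hU

lemma Sec.exists_glue {ι : Type*} {U : X.Opens} (V : ι → X.Opens) (hV : ∀ j, V j ≤ U)
    (hU : U ≤ ⨆ j, V j) (s : ∀ j, Sec i m (V j))
    (h : ∀ j j', Sec.res i m (inf_le_left : V j ⊓ V j' ≤ V j) (s j) =
      Sec.res i m (inf_le_right : V j ⊓ V j' ≤ V j') (s j')) :
    ∃ t : Sec i m U, ∀ j, Sec.res i m (hV j) t = s j := by
  have hcov : ∀ a, U ⊓ chart i a ≤ ⨆ j, V j ⊓ chart i a := fun a => by
    rw [← iSup_inf_eq]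
    exact inf_le_inf_right _ hU
  have key : ∀ a, ∃ t : Fun i (U ⊓ chart i a),
      ∀ j, Fun.res i (inf_le_inf_right _ (hV j)) t = (s j).1 a := fun a => by
    refine Fun.exists_glue i (fun j => V j ⊓ chart i a)
      (fun j => inf_le_inf_right _ (hV j)) (hcov a) (fun j => (s j).1 a) fun j j' => ?_
    have h1 := congrArg (fun s => Fun.res i
      (le_inf (inf_le_inf inf_le_left inf_le_left) (inf_le_left.trans inf_le_right) :
        V j ⊓ chart i a ⊓ (V j' ⊓ chart i a) ≤ V j ⊓ V j' ⊓ chart i a) (s.1 a)) (h j j')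
    simpa only [Sec.res_apply, Fun.res_res] using h1
  choose t ht using key
  refine ⟨⟨t, fun a b => ?_⟩, fun j => Sec.ext fun a => ht a j⟩
  refine Fun.eq_of_res i (fun j => chart i a ⊓ (V j ⊓ chart i b))
    (fun j => inf_le_inf_left _ (inf_le_inf_right _ (hV j))) ?_ fun j => ?_
  · rw [← inf_iSup_eq]
    exact inf_le_inf_left _ (hcov b)
  · have h1 := (s j).2 a b
    rw [← ht, ← ht] at h1
    simpa only [map_mul, map_pow, Fun.res_res, Fun.res_coord] using h1

variable (i m) in
/-- The section of `𝒪(m)` defined by a homogeneous polynomial of degree `m`. -/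
def polySec (U : X.Opens) : gr k r m →ₗ[k] Sec i m U :=
  LinearMap.codRestrict _ (LinearMap.pi fun a =>
    (dehom i a (inf_le_right : U ⊓ chart i a ≤ chart i a)).toLinearMap ∘ₗ (gr k r m).subtype)
    fun f a b => by
      simp only [LinearMap.pi_apply, LinearMap.comp_apply, AlgHom.toLinearMap_apply,
        Submodule.subtype_apply]
      rw [res_dehom, res_dehom]
      exact dehom_eq_coord_pow_mul i _ _ f.2

lemma polySec_apply (U : X.Opens) (f : gr k r m) (a : Fin (r + 1)) :
    (polySec i m U f).1 a = dehom i a (inf_le_right : U ⊓ chart i a ≤ chart i a) f.1 := rfl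

variable (i m) in
/-- Multiplication of sections of `𝒪(m)` by a homogeneous polynomial of degree `n`. -/
def mulSec (U : X.Opens) {n : ℕ} {F : MvPolynomial (Fin (r + 1)) k} (hF : F ∈ gr k r n) :
    Sec i m U →ₗ[k] Sec i (m + n) U :=
  LinearMap.restrict
    (LinearMap.pi fun a => LinearMap.mulLeft k
      (dehom i a (inf_le_right : U ⊓ chart i a ≤ chart i a) F) ∘ₗ LinearMap.proj a)
    fun s hs a b => by
      have h1 := hs a b
      simp only [LinearMap.pi_apply, LinearMap.comp_apply, LinearMap.proj_apply,
        LinearMap.mulLeft_apply, map_mul, res_dehom] at h1 ⊢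
      rw [h1, dehom_eq_coord_pow_mul i (inf_le_left) (inf_le_right.trans inf_le_right) hF]
      ring

lemma mulSec_apply (U : X.Opens) {n : ℕ} {F : MvPolynomial (Fin (r + 1)) k} (hF : F ∈ gr k r n)
    (s : Sec i m U) (a : Fin (r + 1)) :
    (mulSec i m U hF s).1 a = dehom i a (inf_le_right : U ⊓ chart i a ≤ chart i a) F * s.1 a := rfl

lemma res_mulSec {U V : X.Opens} (h : V ≤ U) {n : ℕ} {F : MvPolynomial (Fin (r + 1)) k}
    (hF : F ∈ gr k r n) (s : Sec i m U) :
    Sec.res i (m + n) h (mulSec i m U hF s) = mulSec i m V hF (Sec.res i m h s) :=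
  Sec.ext fun a => by simp only [Sec.res_apply, mulSec_apply, map_mul, res_dehom]

lemma inf_chart_le_preimage {Y : Scheme.{u}} (φ : Y ⟶ X) (U : X.Opens) (a : Fin (r + 1)) :
    φ ⁻¹ᵁ U ⊓ chart (φ ≫ i) a ≤ φ ⁻¹ᵁ (U ⊓ chart i a) := le_rfl

variable (i m) in
/-- Restriction of sections of `𝒪(m)` over `U` along a morphism `φ : Y ⟶ X`. -/
def Sec.pull {Y : Scheme.{u}} (φ : Y ⟶ X) (U : X.Opens) :
    Sec i m U →ₗ[k] Sec (φ ≫ i) m (φ ⁻¹ᵁ U) :=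
  LinearMap.restrict
    (LinearMap.pi fun a => (Fun.pull i φ (inf_chart_le_preimage φ U a)).toLinearMap ∘ₗ
      LinearMap.proj a)
    (by
      intro s hs a b
      have h1 : chart (φ ≫ i) a ⊓ (φ ⁻¹ᵁ U ⊓ chart (φ ≫ i) b) ≤
        φ ⁻¹ᵁ (chart i a ⊓ (U ⊓ chart i b)) := le_rfl
      have key := congrArg (Fun.pull i φ h1) (hs a b)
      rw [map_mul, map_pow, Fun.pull_coord i φ a b _ _ (inf_le_right.trans inf_le_right)] at key
      simp only [LinearMap.pi_apply, LinearMap.comp_apply, LinearMap.proj_apply,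
        AlgHom.toLinearMap_apply]
      rw [Fun.res_pull i φ _ inf_le_right inf_le_right h1,
        Fun.res_pull i φ _ _ (le_inf (inf_le_right.trans inf_le_left) inf_le_left) h1]
      exact key)

lemma Sec.pull_apply {Y : Scheme.{u}} (φ : Y ⟶ X) (U : X.Opens) (s : Sec i m U)
    (a : Fin (r + 1)) :
    (Sec.pull i m φ U s).1 a = Fun.pull i φ (inf_chart_le_preimage φ U a) (s.1 a) := rfl

lemma Sec.res_pull {Y : Scheme.{u}} (φ : Y ⟶ X) {U V : X.Opens} (h : V ≤ U)
    (h' : φ ⁻¹ᵁ V ≤ φ ⁻¹ᵁ U) (s : Sec i m U) :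
    Sec.res (φ ≫ i) m h' (Sec.pull i m φ U s) = Sec.pull i m φ V (Sec.res i m h s) :=
  Sec.ext fun a => Fun.res_pull i φ (inf_chart_le_preimage φ U a) (inf_le_inf_right _ h')
    (inf_le_inf_right _ h) (inf_chart_le_preimage φ V a) (s.1 a)

lemma Sec.pull_mulSec {Y : Scheme.{u}} (φ : Y ⟶ X) (U : X.Opens) {n : ℕ}
    {F : MvPolynomial (Fin (r + 1)) k} (hF : F ∈ gr k r n) (s : Sec i m U) :
    Sec.pull i (m + n) φ U (mulSec i m U hF s) =
      mulSec (φ ≫ i) m (φ ⁻¹ᵁ U) hF (Sec.pull i m φ U s) :=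
  Sec.ext fun a => by
    rw [Sec.pull_apply, mulSec_apply, map_mul, pull_dehom i φ _ _ inf_le_right]
    rfl

lemma Sec.pull_polySec {Y : Scheme.{u}} (φ : Y ⟶ X) (U : X.Opens) (f : gr k r m) :
    Sec.pull i m φ U (polySec i m U f) = polySec (φ ≫ i) m (φ ⁻¹ᵁ U) f :=
  Sec.ext fun a => by
    rw [Sec.pull_apply, polySec_apply, pull_dehom i φ _ _ inf_le_right]
    rfl

end

/-! ### The hyperplane section: local equation, regularity of `ℓ`, finiteness. -/

noncomputable section

lemma two_le_topologicalKrullDim {T : Type*} [TopologicalSpace T] {x y z : T} (hxy : x ⤳ y)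
    (hyz : y ⤳ z) (hyx : ¬ y ⤳ x) (hzy : ¬ z ⤳ y) : 2 ≤ topologicalKrullDim T := by
  let c (x : T) : TopologicalSpace.IrreducibleCloseds T :=
    ⟨closure {x}, isIrreducible_singleton.closure, isClosed_closure⟩
  have hlt {x y : T} (h : x ⤳ y) (h' : ¬ y ⤳ x) : c y < c x := by
    have hle (x y : T) : c x ≤ c y ↔ y ⤳ x := by
      rw [specializes_iff_closure_subset]
      rfl
    rw [lt_iff_le_not_ge, hle, hle]
    exact ⟨h, h'⟩
  let s : LTSeries (TopologicalSpace.IrreducibleCloseds T) :=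
    ⟨2, ![c z, c y, c x], fun j => by
      fin_cases j
      · exact hlt hyz hzy
      · exact hlt hxy hyx⟩
  exact Order.LTSeries.length_le_krullDim s

variable {k : Type u} [Field k] {r : ℕ} {X : Scheme.{u}} {i : X ⟶ PP k r}
  {ℓ : MvPolynomial (Fin (r + 1)) k}

lemma isLocallyNoetherian_of_isClosedImmersion (i : X ⟶ PP k r) [IsClosedImmersion i] :
    IsLocallyNoetherian X := by
  refine isLocallyNoetherian_of_affine_cover
    (S := fun b : Fin (r + 1) => ⟨chart i b, isAffineOpen_chart i b⟩) (iSup_chart i) fun b => ?_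
  exact isNoetherianRing_of_surjective (MvPolynomial (Fin (r + 1)) k) (Fun i (chart i b))
    (dehom i b le_rfl).toRingHom (dehom_surjective i b)

lemma fromSpec_specializes_iff {U : X.Opens} (hU : IsAffineOpen U) (p q : PrimeSpectrum Γ(X, U)) :
    hU.fromSpec p ⤳ hU.fromSpec q ↔ p ≤ q :=
  hU.fromSpec.isOpenEmbedding.isInducing.specializes_iff.trans
    (PrimeSpectrum.le_iff_specializes p q).symm

lemma appLE_SpecMap_fromSpec {U : X.Opens} (hU : IsAffineOpen U) {R : CommRingCat.{u}}
    (φ : Γ(X, U) ⟶ R) (h : ⊤ ≤ (Spec.map φ ≫ hU.fromSpec) ⁻¹ᵁ U) :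
    (Spec.map φ ≫ hU.fromSpec).appLE U ⊤ h = φ ≫ (Scheme.ΓSpecIso R).inv := by
  rw [Scheme.Hom.comp_appLE, hU.fromSpec_app_self, Category.assoc, Scheme.ΓSpecIso_inv_naturality]
  congr 1

/-- The generic point of a component through the point p specializes to p, hence lies in U and is a
prime contained in p. By minimality it is p. -/
lemma closure_mem_irreducibleComponents {U : X.Opens} (hU : IsAffineOpen U)
    {p : PrimeSpectrum Γ(X, U)} (hp : p.asIdeal ∈ minimalPrimes Γ(X, U)) :
    closure {hU.fromSpec p} ∈ irreducibleComponents X := by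
  let x : X := hU.fromSpec p
  have hxU : x ∈ U := by
    have : x ∈ Set.range hU.fromSpec := ⟨p, rfl⟩
    rwa [hU.range_fromSpec] at this
  have hZ := isIrreducible_irreducibleComponent (x := x)
  have hη := hZ.isGenericPoint_genericPoint isClosed_irreducibleComponent
  have hs : hZ.genericPoint ⤳ x := hη.specializes mem_irreducibleComponent
  have hηU : hZ.genericPoint ∈ Set.range hU.fromSpec := by
    rw [hU.range_fromSpec]
    exact hs.mem_open U.2 hxU
  obtain ⟨q, hq⟩ : ∃ q : PrimeSpectrum Γ(X, U), hU.fromSpec q = hZ.genericPoint := hηU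
  have hqp : q ≤ p := by
    rw [← fromSpec_specializes_iff hU, hq]
    exact hs
  have : q = p := le_antisymm hqp (hp.2 ⟨q.2, bot_le⟩ hqp)
  subst this
  rw [hq, hη.def]
  exact irreducibleComponent_mem_irreducibleComponents x

lemma mem_basicOpen_of_mem_minimalPrimes (hℓ : ℓ ∈ gr k r 1) (hCℓ : ContainsNoComponent i ℓ)
    {U : X.Opens} (hU : IsAffineOpen U) {b : Fin (r + 1)} (h : U ≤ chart i b)
    {p : PrimeSpectrum Γ(X, U)} (hp : p.asIdeal ∈ minimalPrimes Γ(X, U)) :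
    dehom i b h ℓ ∉ p.asIdeal := by
  obtain ⟨z, hz, hz'⟩ := hCℓ _ (closure_mem_irreducibleComponents hU hp)
  have hs : hU.fromSpec p ⤳ z := specializes_iff_mem_closure.mpr hz
  have h1 : z ∈ i ⁻¹ᵁ Proj.basicOpen (gr k r) ℓ := by
    by_contra h'
    exact hz' h'
  have h2 : hU.fromSpec p ∈ U ⊓ i ⁻¹ᵁ Proj.basicOpen (gr k r) ℓ := by
    refine ⟨?_, hs.mem_open (i ⁻¹ᵁ Proj.basicOpen (gr k r) ℓ).2 h1⟩
    have : hU.fromSpec p ∈ Set.range hU.fromSpec := ⟨p, rfl⟩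
    rwa [hU.range_fromSpec] at this
  rw [← basicOpen_dehom i b h hℓ] at h2
  have h3 := hU.fromSpec_preimage_basicOpen (dehom i b h ℓ)
  have h4 : p ∈ PrimeSpectrum.basicOpen (R := Γ(X, U)) (dehom i b h ℓ) := h3 ▸ h2
  exact h4

/-- In a noetherian ring the zero divisors form the union of the associated primes. These are
minimal as there are no embedded points, and `ℓ` lies in no minimal prime as H contains no
component. -/
lemma dehom_mem_nonZeroDivisors (hC : IsCurve i) (hℓ : ℓ ∈ gr k r 1)
    (hCℓ : ContainsNoComponent i ℓ) {U : X.Opens} (hU : IsAffineOpen U) {b : Fin (r + 1)}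
    (h : U ≤ chart i b) : dehom i b h ℓ ∈ nonZeroDivisors (Fun i U) := by
  have := hC.isClosedImmersion
  have := isLocallyNoetherian_of_isClosedImmersion i
  have : IsNoetherianRing Γ(X, U) := IsLocallyNoetherian.component_noetherian ⟨U, hU⟩
  by_contra h'
  have h1 : dehom i b h ℓ ∈ ((nonZeroDivisors Γ(X, U) : Set Γ(X, U)))ᶜ := h'
  rw [← biUnion_associatedPrimes_eq_compl_nonZeroDivisors] at h1
  obtain ⟨p, hp, hp'⟩ := Set.mem_iUnion₂.mp h1
  have hmin := hC.associatedPrimes_subset ⟨U, hU⟩ hp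
  exact mem_basicOpen_of_mem_minimalPrimes hℓ hCℓ hU h (p := ⟨p, hmin.1.1⟩) hmin hp'

/-- A prime containing `ℓ` is not minimal. A strict inclusion p < q would therefore extend to a
chain of three primes inside one component, which has dimension one. -/
lemma eq_of_dehom_mem (hC : IsCurve i) (hℓ : ℓ ∈ gr k r 1) (hCℓ : ContainsNoComponent i ℓ)
    {U : X.Opens} (hU : IsAffineOpen U) {b : Fin (r + 1)} (h : U ≤ chart i b)
    {p q : PrimeSpectrum Γ(X, U)} (hp : dehom i b h ℓ ∈ p.asIdeal) (hpq : p ≤ q) : p = q := by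
  by_contra hne
  obtain ⟨p₀, hp₀, hle⟩ := Ideal.exists_minimalPrimes_le (bot_le : ⊥ ≤ p.asIdeal)
  let P : PrimeSpectrum Γ(X, U) := ⟨p₀, hp₀.1.1⟩
  have hPp : P < p := lt_of_le_of_ne hle fun h' =>
    mem_basicOpen_of_mem_minimalPrimes hℓ hCℓ hU h (p := P) hp₀ (h' ▸ hp)
  have hpq' : p < q := lt_of_le_of_ne hpq hne
  have hmem {p : PrimeSpectrum Γ(X, U)} (h : P ≤ p) :
      hU.fromSpec p ∈ closure {hU.fromSpec P} :=
    specializes_iff_mem_closure.mp ((fromSpec_specializes_iff hU _ _).mpr h)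
  have hd := hC.dim_eq_one _ (closure_mem_irreducibleComponents hU (p := P) hp₀)
  have hs {p q : PrimeSpectrum Γ(X, U)} (hp : P ≤ p) (hq : P ≤ q) :
      (⟨_, hmem hp⟩ : closure {hU.fromSpec P}) ⤳ ⟨_, hmem hq⟩ ↔ p ≤ q :=
    Topology.IsInducing.subtypeVal.specializes_iff.symm.trans (fromSpec_specializes_iff hU p q)
  have hPq := hPp.trans hpq'
  have := two_le_topologicalKrullDim ((hs le_rfl hPp.le).mpr hPp.le)
    ((hs hPp.le hPq.le).mpr hpq'.le) (fun h' => hPp.not_ge ((hs hPp.le le_rfl).mp h'))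
    (fun h' => hpq'.not_ge ((hs hPq.le hPp.le).mp h'))
  rw [hd] at this
  exact absurd this (by decide)

lemma preimage_le_chart {Y : Scheme.{u}} (φ : Y ⟶ X) {U : X.Opens} {b : Fin (r + 1)}
    (h : U ≤ chart i b) : φ ⁻¹ᵁ U ≤ chart (φ ≫ i) b := φ.preimage_mono h

/-- Needed because the two maps from C ∩ H to ℙ^r, through C and through H, are equal but not
definitionally so. -/
lemma dehom_eq_zero_congr {Z : Scheme.{u}} {j j' : Z ⟶ PP k r} (e : j = j') {b : Fin (r + 1)}
    {U : Z.Opens} (h : U ≤ chart j b) (h' : U ≤ chart j' b)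
    {f : MvPolynomial (Fin (r + 1)) k} (h0 : dehom j b h f = 0) : dehom j' b h' f = 0 := by
  subst e
  exact h0

variable (i ℓ) in
/-- The inclusion of the scheme-theoretic intersection of `X` and the hyperplane `ℓ = 0` in `X`. -/
abbrev hyperplaneSectionι : Limits.pullback i (Hyperplane.ι ℓ) ⟶ X :=
  Limits.pullback.fst i (Hyperplane.ι ℓ)

lemma dehom_hyperplaneSection (hℓ : ℓ ∈ gr k r 1) (h0 : ℓ ≠ 0) {b : Fin (r + 1)}
    {U : (Limits.pullback i (Hyperplane.ι ℓ)).Opens} (h : U ≤ chart (hyperplaneSectionι i ℓ ≫ i) b) :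
    dehom (hyperplaneSectionι i ℓ ≫ i) b h ℓ = 0 := by
  have e : Limits.pullback.snd i (Hyperplane.ι ℓ) ≫ Hyperplane.ι ℓ = hyperplaneSectionι i ℓ ≫ i :=
    Limits.pullback.condition.symm
  have h' : U ≤ chart (Limits.pullback.snd i (Hyperplane.ι ℓ) ≫ Hyperplane.ι ℓ) b := by
    rwa [e]
  refine dehom_eq_zero_congr e h' h ?_
  rw [← pull_dehom (Hyperplane.ι ℓ) (Limits.pullback.snd i (Hyperplane.ι ℓ)) le_rfl h',
    dehom_eq_zero_of_dvd hℓ h0 b le_rfl (Or.inl dvd_rfl), map_zero]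

/-- By the universal property, Spec of Γ(X, U) / (ℓ / x_b) maps to X and, as `ℓ` vanishes on it, to
H. It therefore maps to the fibre product, so a function vanishing on X ∩ H vanishes in the
quotient. -/
lemma pull_hyperplaneSection_eq_zero_iff (hℓ : ℓ ∈ gr k r 1) (h0 : ℓ ≠ 0) {U : X.Opens}
    (hU : IsAffineOpen U) {b : Fin (r + 1)} (h : U ≤ chart i b) (s : Fun i U) :
    Fun.pull i (hyperplaneSectionι i ℓ) (le_refl (hyperplaneSectionι i ℓ ⁻¹ᵁ U)) s = 0 ↔
      ∃ t, s = dehom i b h ℓ * t := by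
  constructor
  · intro hs
    let I : Ideal Γ(X, U) := Ideal.span {dehom i b h ℓ}
    let y : Spec (.of (Γ(X, U) ⧸ I)) ⟶ X :=
      Spec.map (CommRingCat.ofHom (Ideal.Quotient.mk I)) ≫ hU.fromSpec
    have htop : ⊤ ≤ y ⁻¹ᵁ U := by
      rw [Scheme.Hom.comp_preimage, hU.fromSpec_preimage_self]
      exact le_rfl
    have hy : y.appLE U ⊤ htop = CommRingCat.ofHom (Ideal.Quotient.mk I) ≫
        (Scheme.ΓSpecIso (.of (Γ(X, U) ⧸ I))).inv := appLE_SpecMap_fromSpec hU _ htop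
    have hyb : ⊤ ≤ chart (y ≫ i) b := htop.trans (preimage_le_chart y h)
    have hyℓ : dehom (y ≫ i) b hyb ℓ = 0 := by
      rw [← pull_dehom i y h htop]
      change (y.appLE U ⊤ htop).hom (dehom i b h ℓ) = 0
      rw [hy]
      have : Ideal.Quotient.mk I (dehom i b h ℓ) = 0 :=
        Ideal.Quotient.eq_zero_iff_mem.mpr (Ideal.mem_span_singleton_self _)
      exact (congrArg (Scheme.ΓSpecIso (.of (Γ(X, U) ⧸ I))).inv.hom this).trans (map_zero _)
    have hqc : QuasiCompact (y ≫ i) := by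
      have : IsLocallyNoetherian (PP k r) := isLocallyNoetherian_of_isClosedImmersion (𝟙 _)
      have : QuasiSeparatedSpace (PP k r) := inferInstance
      generalize y ≫ i = w
      exact quasiCompact_of_compactSpace w
    obtain ⟨f, hf⟩ := exists_fac_hyperplane hℓ h0 (y ≫ i) fun c => by
      rw [dehom_eq_coord_pow_mul (y ≫ i) (le_top.trans hyb) le_rfl hℓ,
        ← res_dehom (y ≫ i) hyb le_top, hyℓ, map_zero, mul_zero]
    have hg : Limits.pullback.lift y f hf.symm ≫ hyperplaneSectionι i ℓ = y :=
      Limits.pullback.lift_fst _ _ _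
    have h1 : (y.appLE U ⊤ htop).hom s = 0 := by
      have h2 : ∀ (y' : Spec (.of (Γ(X, U) ⧸ I)) ⟶ X) (e : y' = y) (h' : ⊤ ≤ y' ⁻¹ᵁ U),
          (y'.appLE U ⊤ h').hom s = 0 → (y.appLE U ⊤ htop).hom s = 0 := by
        rintro _ rfl _ h
        exact h
      have h3 : ⊤ ≤ (Limits.pullback.lift y f hf.symm ≫ hyperplaneSectionι i ℓ) ⁻¹ᵁ U := by
        rw [hg]
        exact htop
      refine h2 _ hg h3 ?_
      rw [Scheme.Hom.comp_appLE]
      refine (congrArg ((Limits.pullback.lift y f hf.symm).appLE (hyperplaneSectionι i ℓ ⁻¹ᵁ U) ⊤ h3).hom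
        (?_ : (hyperplaneSectionι i ℓ).app U s = 0)).trans (map_zero _)
      rw [Scheme.Hom.app_eq_appLE]
      exact hs
    rw [hy] at h1
    have h3 : Ideal.Quotient.mk I s = 0 :=
      (ConcreteCategory.bijective_of_isIso (Scheme.ΓSpecIso (.of (Γ(X, U) ⧸ I))).inv).1
        (h1.trans (map_zero _).symm)
    exact Ideal.mem_span_singleton.mp (Ideal.Quotient.eq_zero_iff_mem.mp h3)
  · rintro ⟨t, rfl⟩
    rw [map_mul, pull_dehom i (hyperplaneSectionι i ℓ) h le_rfl
      (preimage_le_chart _ h), dehom_hyperplaneSection hℓ h0, zero_mul]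

lemma pull_hyperplaneSection_surjective {U : X.Opens} (hU : IsAffineOpen U) :
    Function.Surjective
      (Fun.pull i (hyperplaneSectionι i ℓ) (le_refl (hyperplaneSectionι i ℓ ⁻¹ᵁ U))) := by
  intro z
  obtain ⟨s, hs⟩ := Scheme.Hom.app_surjective (hyperplaneSectionι i ℓ) U hU z
  refine ⟨s, ?_⟩
  rw [Scheme.Hom.app_eq_appLE] at hs
  exact hs

/-- Primes here pull back to primes of Γ(X, U) containing `ℓ`, between which there are no strict
inclusions. -/
lemma krullDimLE_zero_hyperplaneSection (hC : IsCurve i) (hℓ : ℓ ∈ gr k r 1) (h0 : ℓ ≠ 0)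
    (hCℓ : ContainsNoComponent i ℓ) {U : X.Opens} (hU : IsAffineOpen U) {b : Fin (r + 1)}
    (h : U ≤ chart i b) :
    Ring.KrullDimLE 0 (Fun (hyperplaneSectionι i ℓ ≫ i) (hyperplaneSectionι i ℓ ⁻¹ᵁ U)) := by
  let π := Fun.pull i (hyperplaneSectionι i ℓ) (le_refl (hyperplaneSectionι i ℓ ⁻¹ᵁ U))
  have hπ : Function.Surjective π := pull_hyperplaneSection_surjective hU
  rw [Ring.krullDimLE_zero_iff]
  intro P hP
  obtain ⟨M, hM, hPM⟩ := P.exists_le_maximal hP.ne_top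
  have hmem : dehom i b h ℓ ∈ P.comap π := by
    rw [Ideal.mem_comap, (pull_hyperplaneSection_eq_zero_iff hℓ h0 hU h _).mpr ⟨1, by rw [mul_one]⟩]
    exact zero_mem _
  let p : PrimeSpectrum Γ(X, U) := ⟨P.comap π, hP.comap π⟩
  let q : PrimeSpectrum Γ(X, U) := ⟨M.comap π, hM.isPrime.comap π⟩
  have hpq : p = q := eq_of_dehom_mem hC hℓ hCℓ hU h hmem (Ideal.comap_mono hPM)
  have hPM' : P.comap π = M.comap π := congrArg PrimeSpectrum.asIdeal hpq
  rwa [Ideal.comap_injective_of_surjective π hπ hPM']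

lemma finite_hyperplaneSection (hC : IsCurve i) (hℓ : ℓ ∈ gr k r 1) (h0 : ℓ ≠ 0)
    (hCℓ : ContainsNoComponent i ℓ) (b : Fin (r + 1)) :
    Module.Finite k
      (Fun (hyperplaneSectionι i ℓ ≫ i) (hyperplaneSectionι i ℓ ⁻¹ᵁ chart i b)) := by
  have := hC.isClosedImmersion
  let π := Fun.pull i (hyperplaneSectionι i ℓ) (le_refl (hyperplaneSectionι i ℓ ⁻¹ᵁ chart i b))
  have hπ : Function.Surjective π :=
    pull_hyperplaneSection_surjective (isAffineOpen_chart i b)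
  have : Algebra.FiniteType k
      (Fun (hyperplaneSectionι i ℓ ≫ i) (hyperplaneSectionι i ℓ ⁻¹ᵁ chart i b)) :=
    Algebra.FiniteType.of_surjective (π.comp (dehom i b le_rfl))
      (hπ.comp (dehom_surjective i b))
  rw [Module.finite_iff_krullDimLE_zero]
  exact krullDimLE_zero_hyperplaneSection hC hℓ h0 hCℓ (isAffineOpen_chart i b) le_rfl

lemma discreteTopology_hyperplaneSection (hC : IsCurve i) (hℓ : ℓ ∈ gr k r 1) (h0 : ℓ ≠ 0)
    (hCℓ : ContainsNoComponent i ℓ) :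
    DiscreteTopology ↥(Limits.pullback i (Hyperplane.ι ℓ)) := by
  have := hC.isClosedImmersion
  rw [discreteTopology_iff_isOpen_singleton]
  intro z
  obtain ⟨b, hb⟩ : ∃ b, z ∈ chart (hyperplaneSectionι i ℓ ≫ i) b :=
    TopologicalSpace.Opens.mem_iSup.mp (iSup_chart (hyperplaneSectionι i ℓ ≫ i) ▸ trivial)
  have hU : IsAffineOpen (hyperplaneSectionι i ℓ ⁻¹ᵁ chart i b) :=
    (isAffineOpen_chart i b).preimage _
  have := finite_hyperplaneSection hC hℓ h0 hCℓ b
  have : IsArtinianRing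
      (Fun (hyperplaneSectionι i ℓ ≫ i) (hyperplaneSectionι i ℓ ⁻¹ᵁ chart i b)) :=
    IsArtinianRing.of_finite k _
  have hd : DiscreteTopology (PrimeSpectrum
      (Fun (hyperplaneSectionι i ℓ ≫ i) (hyperplaneSectionι i ℓ ⁻¹ᵁ chart i b))) := inferInstance
  have hz : z ∈ Set.range hU.fromSpec := by
    rw [hU.range_fromSpec]
    exact hb
  obtain ⟨p, rfl⟩ := hz
  have h1 := hU.fromSpec.isOpenEmbedding.isOpenMap {p} (@isOpen_discrete _ _ hd {p})
  rwa [Set.image_singleton] at h1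

end

/-! ### The exact sequence of multiplication by `ℓ`. -/

noncomputable section
variable {k : Type u} [Field k] {r : ℕ} {X : Scheme.{u}} {i : X ⟶ PP k r}
  {ℓ : MvPolynomial (Fin (r + 1)) k} {m : ℕ}

variable (i) in
/-- An open subset whose intersection with each standard chart is affine. -/
def AffineOnCharts (U : X.Opens) : Prop := ∀ a, IsAffineOpen (U ⊓ chart i a)

lemma affineOnCharts_top [IsAffineHom i] : AffineOnCharts i ⊤ := fun a => by
  rw [top_inf_eq]
  exact isAffineOpen_chart i a

lemma affineOnCharts_of_le [IsAffineHom i] {U : X.Opens} {b : Fin (r + 1)} (hU : IsAffineOpen U)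
    (h : U ≤ chart i b) : AffineOnCharts i U := isAffineOpen_chart_inf i hU h

lemma mulSec_injective (hC : IsCurve i) (hℓ : ℓ ∈ gr k r 1) (hCℓ : ContainsNoComponent i ℓ)
    {U : X.Opens} (hU : AffineOnCharts i U) : Function.Injective (mulSec i m U hℓ) := by
  rw [injective_iff_map_eq_zero]
  intro s hs
  refine Sec.ext fun a => ?_
  have h1 := congrArg (fun s => s.1 a) hs
  exact (mul_right_mem_nonZeroDivisors_eq_zero_iff
    (dehom_mem_nonZeroDivisors hC hℓ hCℓ (hU a) inf_le_right)).mp ((mul_comm _ _).trans h1)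

/-- The quotients by `ℓ` exist chart by chart. They satisfy the transition rule because it holds
after multiplication by the nonzerodivisor `ℓ`. -/
lemma exists_mulSec_eq (hC : IsCurve i) (hℓ : ℓ ∈ gr k r 1) (h0 : ℓ ≠ 0)
    (hCℓ : ContainsNoComponent i ℓ) {U : X.Opens} (hU : AffineOnCharts i U) {s : Sec i (m + 1) U}
    (hs : Sec.pull i (m + 1) (hyperplaneSectionι i ℓ) U s = 0) :
    ∃ t, mulSec i m U hℓ t = s := by
  have := hC.isClosedImmersion
  have h1 : ∀ a, ∃ t, s.1 a = dehom i a inf_le_right ℓ * t := fun a =>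
    (pull_hyperplaneSection_eq_zero_iff hℓ h0 (hU a) inf_le_right _).mp
      (congrArg (fun s => s.1 a) hs)
  choose t ht using h1
  refine ⟨⟨t, fun a b => ?_⟩, Sec.ext fun a => (ht a).symm⟩
  have hab : IsAffineOpen (chart i a ⊓ (U ⊓ chart i b)) := by
    rw [inf_comm]
    exact isAffineOpen_chart_inf i (hU b) inf_le_right a
  have hnz := dehom_mem_nonZeroDivisors hC hℓ hCℓ hab
    (inf_le_right.trans inf_le_right : _ ≤ chart i b)
  have h2 := s.2 a b
  rw [ht, ht, map_mul, map_mul, res_dehom, res_dehom, ← sub_eq_zero] at h2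
  rw [← sub_eq_zero, ← mul_right_mem_nonZeroDivisors_eq_zero_iff hnz, ← h2,
    dehom_eq_coord_pow_mul i inf_le_left (inf_le_right.trans inf_le_right) hℓ]
  ring

lemma pull_sec_surjective {U : X.Opens} (hU : IsAffineOpen U)
    {c : Fin (r + 1)} (h : U ≤ chart i c) :
    Function.Surjective (Sec.pull i m (hyperplaneSectionι i ℓ) U) := by
  intro z
  obtain ⟨s, hs⟩ := pull_hyperplaneSection_surjective (i := i) (ℓ := ℓ) hU
    (Fun.res (hyperplaneSectionι i ℓ ≫ i) (le_inf le_rfl (preimage_le_chart _ h)) (z.1 c))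
  refine ⟨Sec.ofFun i m c s, Sec.ext_of_le (preimage_le_chart _ h) ?_⟩
  rw [Sec.pull_apply, Sec.ofFun_apply_self,
    ← Fun.res_pull i (hyperplaneSectionι i ℓ) le_rfl inf_le_left _ _, hs, Fun.res_res,
    Fun.res_self]

lemma mulSec_hyperplaneSection (hℓ : ℓ ∈ gr k r 1) (h0 : ℓ ≠ 0)
    {U : (Limits.pullback i (Hyperplane.ι ℓ)).Opens} (s : Sec (hyperplaneSectionι i ℓ ≫ i) m U) :
    mulSec (hyperplaneSectionι i ℓ ≫ i) m U hℓ s = 0 :=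
  Sec.ext fun a => by
    rw [mulSec_apply, dehom_hyperplaneSection hℓ h0, zero_mul]
    rfl

lemma exists_of_subsingleton_H1 (h : Subsingleton (H1 i m))
    (t : ∀ a b, Sec i m (chart i a ⊓ chart i b)) (ht : cechD1 i m t = 0) :
    ∃ u : ∀ a, Sec i m (chart i a),
      ∀ a b, t a b = Sec.res i m inf_le_right (u b) - Sec.res i m inf_le_left (u a) := by
  have h1 := Submodule.Quotient.subsingleton_iff.mp h
  have h2 : (⟨t, ht⟩ : LinearMap.ker (cechD1 i m)) ∈
      (LinearMap.range (cechD0 i m)).submoduleOf (LinearMap.ker (cechD1 i m)) := h1 ▸ trivial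
  obtain ⟨u, hu⟩ := h2
  exact ⟨u, fun a b => (congrArg (fun t => t a b) hu).symm⟩

/-- The connecting homomorphism, made explicit. Local lifts `s a` of z differ by `ℓ` times `t a b`,
and `t` is a cocycle since `ℓ` is regular. Writing `t` as the coboundary of `v`, the corrected lifts
s_a - ℓ v_a glue and still restrict to z. -/
lemma pullback_surjective_of_H1 (hC : IsCurve i) (hℓ : ℓ ∈ gr k r 1) (h0 : ℓ ≠ 0)
    (hCℓ : ContainsNoComponent i ℓ) (hH : Subsingleton (H1 i m)) :
    Function.Surjective (pullback i (hyperplaneSectionι i ℓ) (m + 1)) := by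
  have := hC.isClosedImmersion
  intro z
  let φ := hyperplaneSectionι i ℓ
  have hz : ∀ a, ∃ s : Sec i (m + 1) (chart i a),
      Sec.pull i (m + 1) φ _ s = Sec.res (φ ≫ i) (m + 1) le_top z := fun a =>
    pull_sec_surjective (isAffineOpen_chart i a) le_rfl _
  choose s hs using hz
  have haff : ∀ a b, IsAffineOpen (chart i a ⊓ chart i b) := fun a b =>
    isAffineOpen_chart_inf i (isAffineOpen_chart i a) le_rfl b
  have hd : ∀ a b, ∃ t : Sec i m (chart i a ⊓ chart i b), mulSec i m _ hℓ t =
      Sec.res i (m + 1) inf_le_right (s b) - Sec.res i (m + 1) inf_le_left (s a) := fun a b => by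
    refine exists_mulSec_eq hC hℓ h0 hCℓ (affineOnCharts_of_le (haff a b) inf_le_left) ?_
    rw [map_sub, ← Sec.res_pull φ inf_le_right (φ.preimage_mono inf_le_right),
      ← Sec.res_pull φ inf_le_left (φ.preimage_mono inf_le_left), hs, hs, Sec.res_res, Sec.res_res,
      sub_self]
  choose t ht using hd
  have hcocycle : cechD1 i m t = 0 := by
    funext a b c
    refine mulSec_injective hC hℓ hCℓ (affineOnCharts_of_le
      (isAffineOpen_chart_inf i (haff a b) inf_le_left c) (inf_le_left.trans inf_le_left)) ?_
    change mulSec i m _ hℓ (Sec.res i m (le_inf (inf_le_left.trans inf_le_right) inf_le_right)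
      (t b c) - Sec.res i m (le_inf (inf_le_left.trans inf_le_left) inf_le_right) (t a c) +
        Sec.res i m inf_le_left (t a b))
      = mulSec i m _ hℓ 0
    rw [map_zero, map_add, map_sub, ← res_mulSec, ← res_mulSec, ← res_mulSec, ht, ht, ht]
    simp only [map_sub, Sec.res_res]
    abel
  obtain ⟨v, hv⟩ := exists_of_subsingleton_H1 hH t hcocycle
  obtain ⟨g, hg⟩ := Sec.exists_glue (i := i) (m := m + 1) (U := ⊤) (chart i) (fun _ => le_top)
    (iSup_chart i).ge (fun a => s a - mulSec i m _ hℓ (v a)) (fun a b => by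
      have h1 := ht a b
      rw [hv, map_sub, ← res_mulSec, ← res_mulSec] at h1
      rw [map_sub, map_sub, sub_eq_sub_iff_sub_eq_sub, ← neg_inj, neg_sub, neg_sub]
      exact h1.symm)
  refine ⟨g, Sec.eq_of_res (fun a => φ ⁻¹ᵁ chart i a) (fun _ => le_top)
    (iSup_chart (φ ≫ i)).ge fun a => ?_⟩
  refine (Sec.res_pull φ le_top (le_top : φ ⁻¹ᵁ chart i a ≤ φ ⁻¹ᵁ ⊤) g).trans ?_
  rw [hg, map_sub, Sec.pull_mulSec, mulSec_hyperplaneSection hℓ h0, sub_zero, hs]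

/-! ### Sections of 𝒪(m) on a discrete scheme. -/

section Discrete

variable {Z : Scheme.{u}} {j : Z ⟶ PP k r}

lemma Sec.subsingleton_bot : Subsingleton (Sec i m ⊥) :=
  ⟨fun _ _ => Sec.eq_of_res (ι := Empty) (fun x => x.elim) (fun x => x.elim) bot_le
    fun x => x.elim⟩

variable (j m) in
/-- The values of a global section of `𝒪(m)` in the trivializations over open subsets `W_a` of the
charts. -/
def trivValues (W : Fin (r + 1) → Z.Opens) (hW : ∀ a, W a ≤ chart j a) :
    H0 j m →ₗ[k] ∀ a, Fun j (W a) :=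
  LinearMap.pi fun a =>
    (Fun.res j (le_inf le_top (hW a) : W a ≤ ⊤ ⊓ chart j a)).toLinearMap ∘ₗ
      LinearMap.proj a ∘ₗ (Sec j m ⊤).subtype

lemma trivValues_apply (W : Fin (r + 1) → Z.Opens) (hW : ∀ a, W a ≤ chart j a) (s : H0 j m)
    (a : Fin (r + 1)) : trivValues m j W hW s a =
      Fun.res j (le_inf le_top (hW a) : W a ≤ ⊤ ⊓ chart j a) (s.1 a) := rfl

lemma trivValues_injective (W : Fin (r + 1) → Z.Opens) (hW : ∀ a, W a ≤ chart j a)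
    (hcov : ⨆ a, W a = ⊤) : Function.Injective (trivValues m j W hW) := by
  intro s t hst
  refine Sec.eq_of_res W (fun _ => le_top) hcov.ge fun a => Sec.ext_of_le (hW a) ?_
  have h1 := congrArg (fun f => Fun.res j (inf_le_left : W a ⊓ chart j a ≤ W a) (f a)) hst
  simpa only [trivValues_apply, Fun.res_res, Sec.res_apply] using h1

lemma trivValues_bijective (W : Fin (r + 1) → Z.Opens) (hW : ∀ a, W a ≤ chart j a)
    (hcov : ⨆ a, W a = ⊤) (hdisj : ∀ a b, a ≠ b → W a ⊓ W b = ⊥) :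
    Function.Bijective (trivValues m j W hW) := by
  refine ⟨trivValues_injective W hW hcov, fun f => ?_⟩
  obtain ⟨s, hs⟩ := Sec.exists_glue (i := j) (m := m) (U := ⊤) W (fun _ => le_top) hcov.ge
    (fun a => Sec.ofFun j m a (f a)) (fun a b => by
      by_cases hab : a = b
      · subst hab
        rfl
      · have : Subsingleton (Sec j m (W a ⊓ W b)) := by
          rw [hdisj a b hab]
          exact Sec.subsingleton_bot
        exact Subsingleton.elim _ _)
  refine ⟨s, funext fun a => ?_⟩
  have h1 := congrArg (fun s => Fun.res j (le_inf le_rfl (hW a) : W a ≤ W a ⊓ chart j a) (s.1 a))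
    (hs a)
  simp only [Sec.ofFun_apply_self, Sec.res_apply, Fun.res_res, Fun.res_self] at h1
  exact h1

lemma trivValues_mulSec_X (W : Fin (r + 1) → Z.Opens) (hW : ∀ a, W a ≤ chart j a)
    (s : H0 j m) (a b : Fin (r + 1)) :
    trivValues (m + 1) j W hW (mulSec j m ⊤ (coord_mem k b) s) a =
      coord j b a (hW a) * trivValues m j W hW s a := by
  rw [trivValues_apply, trivValues_apply, mulSec_apply, map_mul, res_dehom, dehom_X]

variable (j) in
lemma exists_disjoint_cover [DiscreteTopology Z] : ∃ W : Fin (r + 1) → Z.Opens,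
    (∀ a, W a ≤ chart j a) ∧ ⨆ a, W a = ⊤ ∧ ∀ a b, a ≠ b → W a ⊓ W b = ⊥ := by
  -- The points whose first nonvanishing coordinate is x_a.
  refine ⟨fun a => ⟨{z | z ∈ chart j a ∧ ∀ b < a, z ∉ chart j b}, isOpen_discrete _⟩,
    fun a z hz => hz.1, ?_, ?_⟩
  · rw [eq_top_iff]
    intro z _
    have hz : ∃ a, z ∈ chart j a := TopologicalSpace.Opens.mem_iSup.mp (iSup_chart j ▸ trivial)
    refine TopologicalSpace.Opens.mem_iSup.mpr ?_
    classical
    obtain ⟨a, ha, hmin⟩ := WellFounded.has_min (α := Fin (r + 1)) wellFounded_lt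
      {a | z ∈ chart j a} hz
    exact ⟨a, ha, fun b hb hb' => hmin b hb' hb⟩
  · intro a b hab
    rw [eq_bot_iff]
    rintro z ⟨⟨ha, ha'⟩, ⟨hb, hb'⟩⟩
    rcases lt_or_gt_of_ne hab with h | h
    · exact (hb' a h ha).elim
    · exact (ha' b h hb).elim

variable (j) in
lemma finrank_H0_eq_of_discreteTopology [DiscreteTopology Z] (m n : ℕ) :
    Module.finrank k (H0 j m) = Module.finrank k (H0 j n) := by
  obtain ⟨W, hW, hcov, hdisj⟩ := exists_disjoint_cover j
  have h (m : ℕ) := (LinearEquiv.ofBijective _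
    (trivValues_bijective (m := m) W hW hcov hdisj)).finrank_eq
  rw [h, h]

lemma pullback_mulSec (φ : Z ⟶ X) {n : ℕ} {F : MvPolynomial (Fin (r + 1)) k} (hF : F ∈ gr k r n)
    (s : H0 i m) :
    pullback i φ (m + n) (mulSec i m ⊤ hF s) = mulSec (φ ≫ i) m ⊤ hF (pullback i φ m s) :=
  Sec.pull_mulSec φ ⊤ hF s

lemma pullback_polySec (φ : Z ⟶ X) (f : gr k r m) :
    pullback i φ m (polySec i m ⊤ f) = polySec (φ ≫ i) m ⊤ f :=
  Sec.pull_polySec φ ⊤ f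

/-- Split Z into disjoint opens W_a on which x_a is invertible. If c_a in degree m restricts to z /
x_a on W_a and to zero on the other pieces, then ∑ x_a c_a restricts to z. No vanishing of H¹ in
higher degrees is needed. -/
lemma pullback_surjective_succ [DiscreteTopology Z] (φ : Z ⟶ X)
    (h : Function.Surjective (pullback i φ m)) :
    Function.Surjective (pullback i φ (m + 1)) := by
  classical
  intro z
  obtain ⟨W, hW, hcov, hdisj⟩ := exists_disjoint_cover (φ ≫ i)
  have h1 : ∀ a, ∃ c : H0 i m, trivValues m (φ ≫ i) W hW (pullback i φ m c) =
      Pi.single a (trivValues (m + 1) (φ ≫ i) W hW z a) := fun a => by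
    obtain ⟨z', hz'⟩ := (trivValues_bijective (m := m) W hW hcov hdisj).2
      (Pi.single a (trivValues (m + 1) (φ ≫ i) W hW z a))
    obtain ⟨c, rfl⟩ := h z'
    exact ⟨c, hz'⟩
  choose c hc using h1
  refine ⟨∑ a, mulSec i m ⊤ (coord_mem k a) (c a),
    trivValues_injective W hW hcov (funext fun b => ?_)⟩
  rw [map_sum, map_sum, Finset.sum_apply, Finset.sum_eq_single b]
  · rw [pullback_mulSec, trivValues_mulSec_X, hc, Pi.single_eq_same, coord_self, one_mul]
  · intro a _ hab
    rw [pullback_mulSec, trivValues_mulSec_X, hc, Pi.single_eq_of_ne' hab, mul_zero]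
  · exact fun h => (h (Finset.mem_univ b)).elim

end Discrete

/-- Rank-nullity for restriction to C ∩ H, whose kernel is `ℓ` times H⁰(𝒪_C(m)). The twist n is
arbitrary since 𝒪(n) is trivial on a discrete scheme. -/
lemma finrank_H0_succ (hC : IsCurve i) (hℓ : ℓ ∈ gr k r 1) (h0 : ℓ ≠ 0)
    (hCℓ : ContainsNoComponent i ℓ) (hfin : Module.Finite k (H0 i (m + 1)))
    (hsurj : Function.Surjective (pullback i (hyperplaneSectionι i ℓ) (m + 1))) (n : ℕ) :
    Module.finrank k (H0 i (m + 1)) =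
      Module.finrank k (H0 (hyperplaneSectionι i ℓ ≫ i) n) + Module.finrank k (H0 i m) := by
  have := hC.isClosedImmersion
  have := discreteTopology_hyperplaneSection hC hℓ h0 hCℓ
  have hker : LinearMap.ker (pullback i (hyperplaneSectionι i ℓ) (m + 1)) =
      LinearMap.range (mulSec i m ⊤ hℓ) := by
    ext s
    constructor
    · intro hs
      exact exists_mulSec_eq hC hℓ h0 hCℓ affineOnCharts_top hs
    · rintro ⟨t, rfl⟩
      rw [LinearMap.mem_ker, pullback_mulSec, mulSec_hyperplaneSection hℓ h0]
  rw [← LinearMap.finrank_range_add_finrank_ker (pullback i (hyperplaneSectionι i ℓ) (m + 1)),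
    hker, LinearMap.finrank_range_of_inj (mulSec_injective hC hℓ hCℓ affineOnCharts_top),
    LinearMap.range_eq_top.mpr hsurj, finrank_top, finrank_H0_eq_of_discreteTopology _ (m + 1) n]

end

/-! ### Sections of high degree are forms; finite-dimensionality of H⁰. -/

noncomputable section
variable {k : Type u} [Field k] {r : ℕ} {X : Scheme.{u}} {i : X ⟶ PP k r}
  {ℓ : MvPolynomial (Fin (r + 1)) k} {m : ℕ}

lemma exists_coord_pow_mul_eq_zero [IsClosedImmersion i] (t : H0 i m) {a : Fin (r + 1)}
    (ht : t.1 a = 0) : ∃ p, ∀ q ≥ p, ∀ b, coord i a b inf_le_right ^ q * t.1 b = 0 := by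
  have h1 : ∀ b, ∃ p, coord i a b inf_le_right ^ p * t.1 b = 0 := fun b => by
    refine exists_pow_mul_eq_zero_of_res_basicOpen_eq_zero_of_isAffineOpen X
      (affineOnCharts_top (i := i) b) (t.1 b) (coord i a b inf_le_right) ?_
    have hle : X.basicOpen (U := ⊤ ⊓ chart i b) (coord i a b inf_le_right) ≤ chart i a := by
      rw [basicOpen_coord]
      exact inf_le_right
    have h2 := Sec.res_apply_eq t (le_inf le_top hle) (Scheme.basicOpen_le _ _)
    rw [ht, map_zero, mul_zero] at h2
    exact h2
  choose p hp using h1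
  refine ⟨Finset.univ.sup p, fun q hq b => ?_⟩
  obtain ⟨c, hc⟩ := Nat.exists_eq_add_of_le ((Finset.le_sup (Finset.mem_univ b)).trans hq)
  rw [hc, add_comm, pow_add, mul_assoc, hp, mul_zero]

/-- On X_a the section s is x_a ^ m · f / x_a ^ n for a form f of degree n. The global section x_a ^
n s - x_a ^ m f vanishes on X_a, hence is killed by a power of x_a. -/
lemma exists_coord_pow_mul_eq_dehom [IsClosedImmersion i] (s : H0 i m) (a : Fin (r + 1)) :
    ∃ p, ∀ q ≥ p, ∃ f ∈ gr k r (m + q), ∀ b,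
      coord i a b inf_le_right ^ q * s.1 b = dehom i b inf_le_right f := by
  obtain ⟨n, f, hf, hfs⟩ := exists_eq_dehom i a
    (Fun.res i (le_inf le_top le_rfl : chart i a ≤ ⊤ ⊓ chart i a) (s.1 a))
  let t : H0 i (m + n) := mulSec i m ⊤ (MvPolynomial.isHomogeneous_X_pow a n) s -
    polySec i (m + n) ⊤ ⟨_, X_pow_mul_mem a m hf⟩
  have ht : ∀ b, t.1 b = coord i a b inf_le_right ^ n * s.1 b -
      dehom i b inf_le_right (MvPolynomial.X a ^ m * f) := fun b => by
    change dehom i b inf_le_right (MvPolynomial.X a ^ n) * s.1 b - _ = _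
    rw [map_pow, dehom_X]
    rfl
  obtain ⟨p, hp⟩ := exists_coord_pow_mul_eq_zero t (a := a) (by
    have h1 := congrArg (Fun.res i (inf_le_right : ⊤ ⊓ chart i a ≤ chart i a)) hfs
    rw [res_dehom, Fun.res_res, Fun.res_self] at h1
    rw [ht, map_mul, map_pow, dehom_X, coord_self, h1, one_pow, one_pow, sub_self])
  refine ⟨n + p, fun q hq => ?_⟩
  obtain ⟨c, rfl⟩ := Nat.exists_eq_add_of_le hq
  refine ⟨MvPolynomial.X a ^ (p + c) * (MvPolynomial.X a ^ m * f), ?_, fun b => ?_⟩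
  · have h1 := X_pow_mul_mem a (p + c) (X_pow_mul_mem a m hf)
    rwa [show p + c + (m + n) = m + (n + p + c) by ring] at h1
  · have h1 := hp (p + c) (by omega) b
    rw [ht, mul_sub, sub_eq_zero] at h1
    rw [map_mul, map_pow, dehom_X, ← h1]
    ring

lemma degree_eq_of_mem_support {n : ℕ} {f : MvPolynomial (Fin (r + 1)) k} (hf : f ∈ gr k r n)
    {v : Fin (r + 1) →₀ ℕ} (hv : v ∈ f.support) : v.degree = n :=
  (DFunLike.congr_fun Finsupp.degree_eq_weight_one v).trans (hf (MvPolynomial.mem_support_iff.mp hv))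

lemma exists_le_of_mul_le_degree {n N : ℕ} (hN : (r + 1) * N ≤ n) {v : Fin (r + 1) →₀ ℕ}
    (hv : v.degree = n) : ∃ a, N ≤ v a := by
  by_contra! h
  have h1 : ∑ a, v a < ∑ _a : Fin (r + 1), N :=
    Finset.sum_lt_sum_of_nonempty Finset.univ_nonempty fun a _ => h a
  rw [Finset.sum_const, Finset.card_univ, Fintype.card_fin, smul_eq_mul,
    ← Finsupp.degree_eq_sum, hv] at h1
  omega

/-- By the pigeonhole principle, a monomial of degree at least (r + 1) N is divisible by some x_a ^
N, and x_a ^ N s is a form for each a. -/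
lemma exists_mul_eq_dehom [IsClosedImmersion i] (s : H0 i m) :
    ∃ N, ∀ n ≥ N, ∀ F ∈ gr k r n, ∃ f ∈ gr k r (m + n), ∀ b,
      dehom i b inf_le_right F * s.1 b = dehom i b inf_le_right f := by
  choose p hp using exists_coord_pow_mul_eq_dehom s
  let N := Finset.univ.sup p
  refine ⟨(r + 1) * N, fun n hn F hF => ?_⟩
  have h1 : ∀ v ∈ F.support, ∃ f ∈ gr k r (m + n), ∀ b,
      dehom i b inf_le_right (MvPolynomial.monomial v (F.coeff v)) * s.1 b =
        dehom i b inf_le_right f := fun v hv => by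
    have hdeg : v.degree = n := degree_eq_of_mem_support hF hv
    obtain ⟨a, ha⟩ := exists_le_of_mul_le_degree hn hdeg
    obtain ⟨f, hf, hfs⟩ := hp a N (Finset.le_sup (Finset.mem_univ a))
    have hsum : Finsupp.single a N + (v - Finsupp.single a N) = v :=
      add_tsub_cancel_of_le (Finsupp.single_le_iff.mpr ha)
    have hdeg' : (v - Finsupp.single a N).degree = n - N := by
      have := congrArg Finsupp.degree hsum
      rw [map_add, Finsupp.degree_single, hdeg] at this
      omega
    have hNn : N ≤ n := (Nat.le_mul_of_pos_left N (Nat.succ_pos r)).trans hn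
    refine ⟨MvPolynomial.monomial (v - Finsupp.single a N) (F.coeff v) * f, ?_, fun b => ?_⟩
    · have h2 := (MvPolynomial.isHomogeneous_monomial (F.coeff v) hdeg').mul hf
      rwa [show n - N + (m + N) = m + n by omega] at h2
    · have h2 : MvPolynomial.monomial v (F.coeff v) = MvPolynomial.X a ^ N *
          MvPolynomial.monomial (v - Finsupp.single a N) (F.coeff v) := by
        rw [MvPolynomial.X_pow_eq_monomial, MvPolynomial.monomial_mul, one_mul, hsum]
      rw [h2, map_mul, map_mul, map_pow, dehom_X, ← hfs]
      ring
  choose! f hf hfs using h1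
  refine ⟨∑ v ∈ F.support, f v, Submodule.sum_mem _ hf, fun b => ?_⟩
  conv_lhs => rw [F.as_sum]
  rw [map_sum, map_sum, Finset.sum_mul]
  exact Finset.sum_congr rfl fun v hv => hfs v hv b

variable (i) in
/-- The homogeneous ideal of a scheme over `ℙ^r`. -/
def homogeneousIdeal : Ideal (MvPolynomial (Fin (r + 1)) k) :=
  Ideal.span {f | ∃ n, f ∈ gr k r n ∧ ∀ b, dehom i b le_rfl f = 0}

lemma mem_homogeneousIdeal {n : ℕ} {f : MvPolynomial (Fin (r + 1)) k} (hf : f ∈ gr k r n)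
    (h : ∀ b, dehom i b le_rfl f = 0) : f ∈ homogeneousIdeal i :=
  Ideal.subset_span ⟨n, hf, h⟩

lemma dehom_eq_zero_of_mem {f : MvPolynomial (Fin (r + 1)) k} (hf : f ∈ homogeneousIdeal i)
    {b : Fin (r + 1)} {U : X.Opens} (h : U ≤ chart i b) : dehom i b h f = 0 := by
  have h1 : homogeneousIdeal i ≤ RingHom.ker (dehom i b (le_refl (chart i b))) :=
    Ideal.span_le.mpr fun f ⟨_, _, hf⟩ => hf b
  rw [← res_dehom i le_rfl h, (RingHom.mem_ker).mp (h1 hf), map_zero]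

variable (i) in
lemma isHomogeneous_homogeneousIdeal : (homogeneousIdeal i).IsHomogeneous (gr k r) :=
  Ideal.homogeneous_span _ _ fun _ ⟨n, hf, _⟩ => ⟨n, hf⟩

lemma exists_X_pow_mul_mem_homogeneousIdeal [IsClosedImmersion i] {n : ℕ} {a : Fin (r + 1)}
    {f : MvPolynomial (Fin (r + 1)) k} (hf : f ∈ gr k r n) (h : dehom i a le_rfl f = 0) :
    ∃ q, MvPolynomial.X a ^ q * f ∈ homogeneousIdeal i := by
  obtain ⟨q, hq⟩ := exists_coord_pow_mul_eq_zero (polySec i n ⊤ ⟨f, hf⟩) (a := a) (by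
    rw [polySec_apply, ← res_dehom i le_rfl inf_le_right, h, map_zero])
  refine ⟨q, mem_homogeneousIdeal (X_pow_mul_mem a q hf) fun b => ?_⟩
  have h1 := congrArg (Fun.res i (le_inf le_top le_rfl : chart i b ≤ ⊤ ⊓ chart i b)) (hq q le_rfl b)
  rw [polySec_apply, ← dehom_X, ← map_pow, ← map_mul, map_zero, res_dehom] at h1
  exact h1

lemma exists_X_pow_mul_mem_sup [IsClosedImmersion i] (hℓ : ℓ ∈ gr k r 1) (h0 : ℓ ≠ 0) {n : ℕ}
    {f : MvPolynomial (Fin (r + 1)) k} (hf : f ∈ gr k r n)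
    (h : ∀ b, dehom (hyperplaneSectionι i ℓ ≫ i) b le_rfl f = 0) (a : Fin (r + 1)) :
    ∃ q, MvPolynomial.X a ^ q * f ∈ homogeneousIdeal i ⊔ Ideal.span {ℓ} := by
  obtain ⟨t, ht⟩ := (pull_hyperplaneSection_eq_zero_iff hℓ h0 (isAffineOpen_chart i a) le_rfl
    (dehom i a le_rfl f)).mp
      ((pull_dehom i (hyperplaneSectionι i ℓ) le_rfl le_rfl le_rfl f).trans (h a))
  obtain ⟨p, g, hg, rfl⟩ := exists_eq_dehom i a t
  have h1 : MvPolynomial.X a ^ (p + 1) * f - MvPolynomial.X a ^ n * (ℓ * g) ∈ gr k r (p + 1 + n) := by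
    refine Submodule.sub_mem _ (X_pow_mul_mem a _ hf) ?_
    have h2 := X_pow_mul_mem a n (MvPolynomial.IsHomogeneous.mul hℓ hg)
    rwa [show n + (1 + p) = p + 1 + n by ring] at h2
  obtain ⟨q, hq⟩ := exists_X_pow_mul_mem_homogeneousIdeal (i := i) (a := a) h1 (by
    simp only [map_sub, map_mul, map_pow, dehom_X, coord_self, one_pow, one_mul, ht, sub_self])
  refine ⟨q + (p + 1), ?_⟩
  have h2 : MvPolynomial.X a ^ (q + (p + 1)) * f =
      MvPolynomial.X a ^ q * (MvPolynomial.X a ^ (p + 1) * f - MvPolynomial.X a ^ n * (ℓ * g)) +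
        MvPolynomial.X a ^ q * MvPolynomial.X a ^ n * g * ℓ := by ring
  rw [h2]
  exact add_mem (Ideal.mem_sup_left hq)
    (Ideal.mem_sup_right (Ideal.mul_mem_left _ _ (Ideal.mem_span_singleton_self ℓ)))

/-- If every element of a generating set of a finitely generated ideal is multiplied into `J` by a
power of each variable, then the elements of high order of the ideal belong to `J`. -/
lemma exists_idealOfVars_pow_inf_le {S : Set (MvPolynomial (Fin (r + 1)) k)}
    {J : Ideal (MvPolynomial (Fin (r + 1)) k)}
    (h : ∀ f ∈ S, ∀ a, ∃ q, MvPolynomial.X a ^ q * f ∈ J) :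
    ∃ n, MvPolynomial.idealOfVars (Fin (r + 1)) k ^ n ⊓ Ideal.span S ≤ J := by
  let 𝔪 := MvPolynomial.idealOfVars (Fin (r + 1)) k
  have hfg : 𝔪.FG := MvPolynomial.idealOfVars_fg _ _
  have h1 : ∀ f ∈ S, ∃ q, 𝔪 ^ q ≤ J.colon {f} := fun f hf => by
    refine Ideal.exists_pow_le_of_le_radical_of_fg ?_ hfg
    refine Ideal.span_le.mpr ?_
    rintro _ ⟨a, rfl⟩
    obtain ⟨q, hq⟩ := h f hf a
    exact ⟨q, Submodule.mem_colon_singleton.mpr hq⟩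
  have h2 : ∃ q, 𝔪 ^ q * Ideal.span S ≤ J := by
    obtain ⟨T, hTS, hT⟩ := Submodule.fg_span_iff_fg_span_finset_subset S |>.mp
      (IsNoetherian.noetherian (Ideal.span S))
    choose! q hq using h1
    refine ⟨T.sup q, ?_⟩
    rw [show Ideal.span S = Ideal.span T from hT, Ideal.mul_le]
    intro x hx y hy
    have hy' : Ideal.span (T : Set (MvPolynomial (Fin (r + 1)) k)) ≤ J.colon {x} :=
      Ideal.span_le.mpr fun f hf => Submodule.mem_colon_singleton.mpr (by
        have := Submodule.mem_colon_singleton.mp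
          (hq f (hTS hf) (Ideal.pow_le_pow_right (Finset.le_sup hf) hx))
        rwa [smul_eq_mul, mul_comm] at this)
    have := Submodule.mem_colon_singleton.mp (hy' hy)
    rwa [smul_eq_mul, mul_comm] at this
  obtain ⟨q, hq⟩ := h2
  -- Artin-Rees: with I the span of S, 𝔪 ^ (c + q) ⊓ I = 𝔪 ^ q (𝔪 ^ c ⊓ I), which lies in 𝔪 ^ q I.
  obtain ⟨c, hc⟩ := Ideal.exists_pow_inf_eq_pow_smul (M := MvPolynomial (Fin (r + 1)) k) 𝔪
    (Ideal.span S)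
  refine ⟨c + q, ?_⟩
  have h3 := hc (c + q) (Nat.le_add_right _ _)
  rw [smul_eq_mul, Ideal.mul_top, Nat.add_sub_cancel_left] at h3
  change 𝔪 ^ (c + q) ⊓ Ideal.span S ≤ J
  rw [h3]
  exact (Submodule.smul_mono le_rfl inf_le_right).trans hq

lemma mem_idealOfVars_pow {n m : ℕ} (h : n ≤ m) {f : MvPolynomial (Fin (r + 1)) k}
    (hf : f ∈ gr k r m) : f ∈ MvPolynomial.idealOfVars (Fin (r + 1)) k ^ n := by
  rw [MvPolynomial.mem_pow_idealOfVars_iff]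
  intro v hv
  exact h.trans (degree_eq_of_mem_support hf hv).ge

/-- The forms vanishing on C ∩ H lie, in large degrees, in I_C + (ℓ), because a power of each
variable multiplies them into it. Taking the component of degree n + 1 makes the cofactor of `ℓ`
homogeneous. -/
lemma exists_forall_eq_mul [IsClosedImmersion i] (hℓ : ℓ ∈ gr k r 1) (h0 : ℓ ≠ 0) :
    ∃ N, ∀ n ≥ N, ∀ f ∈ gr k r (n + 1),
      (∀ b, dehom (hyperplaneSectionι i ℓ ≫ i) b le_rfl f = 0) →
      ∃ g ∈ gr k r n, f - ℓ * g ∈ homogeneousIdeal i := by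
  obtain ⟨N, hN⟩ := exists_idealOfVars_pow_inf_le
    (S := {f | ∃ n, f ∈ gr k r n ∧ ∀ b, dehom (hyperplaneSectionι i ℓ ≫ i) b le_rfl f = 0})
    (J := homogeneousIdeal i ⊔ Ideal.span {ℓ})
    fun f ⟨n, hf, h⟩ => exists_X_pow_mul_mem_sup hℓ h0 hf h
  refine ⟨N, fun n hn f hf h => ?_⟩
  have h1 := hN ⟨mem_idealOfVars_pow (by omega) hf, Ideal.subset_span ⟨n + 1, hf, h⟩⟩
  obtain ⟨u, hu, w, hw, huw⟩ := Submodule.mem_sup.mp h1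
  obtain ⟨v, rfl⟩ := Ideal.mem_span_singleton.mp hw
  refine ⟨_, (DirectSum.decompose (gr k r) v n).2, ?_⟩
  have h2 : (DirectSum.decompose (gr k r) f (n + 1) : MvPolynomial (Fin (r + 1)) k) = f :=
    DirectSum.decompose_of_mem_same _ hf
  have h3 : (DirectSum.decompose (gr k r) (ℓ * v) (n + 1) : MvPolynomial (Fin (r + 1)) k) =
      ℓ * DirectSum.decompose (gr k r) v n := by
    rw [Nat.add_comm n 1]
    exact DirectSum.coe_decompose_mul_add_of_left_mem (gr k r) hℓ
  rw [← huw, DirectSum.decompose_add, DirectSum.add_apply, Submodule.coe_add, h3, huw] at h2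
  rw [← eq_sub_iff_add_eq] at h2
  rw [← h2]
  exact isHomogeneous_homogeneousIdeal i _ hu

/-- Some ℓ ^ n s is a form, and the factors `ℓ` are removed one at a time: a form representing a
multiple of `ℓ` vanishes on C ∩ H, so it is ℓg modulo I_C, and `ℓ` is regular on C. The exponent n
depends on s, but the bound N does not, and all degrees involved exceed m ≥ N. -/
lemma exists_polySec_surjective (hC : IsCurve i) (hℓ : ℓ ∈ gr k r 1) (h0 : ℓ ≠ 0)
    (hCℓ : ContainsNoComponent i ℓ) :
    ∃ N, ∀ m ≥ N, Function.Surjective (polySec i m ⊤) := by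
  have := hC.isClosedImmersion
  obtain ⟨N, hN⟩ := exists_forall_eq_mul (i := i) hℓ h0
  refine ⟨N, fun m hm s => ?_⟩
  have key : ∀ n, ∀ f ∈ gr k r (m + n), (∀ b, dehom i b inf_le_right ℓ ^ n * s.1 b =
      dehom i b inf_le_right f) → ∃ f ∈ gr k r m, ∀ b, s.1 b = dehom i b inf_le_right f := by
    intro n
    induction n with
    | zero => exact fun f hf h => ⟨f, hf, fun b => by rw [← h, pow_zero, one_mul]⟩
    | succ n ih =>
      intro f hf h
      obtain ⟨g, hg, hfg⟩ := hN (m + n) (by omega) f hf fun b => by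
        have h1 := congrArg (Fun.res i (le_inf le_top le_rfl : chart i b ≤ ⊤ ⊓ chart i b)) (h b)
        rw [map_mul, map_pow, res_dehom, res_dehom] at h1
        exact (pull_dehom i (hyperplaneSectionι i ℓ) le_rfl le_rfl le_rfl f).symm.trans
          ((pull_hyperplaneSection_eq_zero_iff hℓ h0 (isAffineOpen_chart i b) le_rfl _).mpr
            ⟨_, by rw [← h1, pow_succ', mul_assoc]⟩)
      refine ih g hg fun b => ?_
      have h1 : dehom i b (inf_le_right : ⊤ ⊓ chart i b ≤ chart i b) (f - ℓ * g) = 0 :=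
        dehom_eq_zero_of_mem hfg _
      rw [map_sub, map_mul, ← h, pow_succ', mul_assoc, ← mul_sub] at h1
      exact sub_eq_zero.mp ((mul_right_mem_nonZeroDivisors_eq_zero_iff
        (dehom_mem_nonZeroDivisors hC hℓ hCℓ (affineOnCharts_top (i := i) b) inf_le_right)).mp
          ((mul_comm _ _).trans h1))
  obtain ⟨n, hn⟩ := exists_mul_eq_dehom s
  obtain ⟨f, hf, hfs⟩ := hn n le_rfl (ℓ ^ n) (by
    have := MvPolynomial.IsHomogeneous.pow hℓ n
    rwa [one_mul] at this)
  obtain ⟨g, hg, hgs⟩ := key n f hf fun b => by rw [← hfs, map_pow]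
  exact ⟨⟨g, hg⟩, Sec.ext fun b => (hgs b).symm⟩

instance finite_gr (n : ℕ) : Module.Finite k (gr k r n) :=
  Module.Finite.iff_fg.mpr (MvPolynomial.homogeneousSubmodule_fg _ _ n)

/-- Large degrees are quotients of spaces of forms; lower ones embed into them through
multiplication by `ℓ`. -/
lemma finite_H0 (hC : IsCurve i) (hℓ : ℓ ∈ gr k r 1) (h0 : ℓ ≠ 0)
    (hCℓ : ContainsNoComponent i ℓ) (m : ℕ) : Module.Finite k (H0 i m) := by
  have := hC.isClosedImmersion
  obtain ⟨N, hN⟩ := exists_polySec_surjective hC hℓ h0 hCℓ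
  have h1 : ∀ n m, N ≤ m + n → Module.Finite k (H0 i m) := by
    intro n
    induction n with
    | zero =>
      intro m hm
      exact Module.Finite.of_surjective _ (hN m hm)
    | succ n ih =>
      intro m hm
      have := ih (m + 1) (by omega)
      exact Module.Finite.of_injective _ (mulSec_injective hC hℓ hCℓ (affineOnCharts_top (i := i)))
  exact h1 N m (Nat.le_add_left _ _)

end

/-! ### Sections of 𝒪(m) on the hyperplane are forms. -/

noncomputable section
variable {k : Type u} [Field k] {r : ℕ} {ℓ : MvPolynomial (Fin (r + 1)) k} {m : ℕ}

lemma exists_eq_mul_of_dvd (hℓ : ℓ ∈ gr k r 1) {n : ℕ} {f : MvPolynomial (Fin (r + 1)) k}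
    (hf : f ∈ gr k r (n + 1)) (h : ℓ ∣ f) : ∃ g ∈ gr k r n, f = ℓ * g := by
  obtain ⟨g, rfl⟩ := h
  refine ⟨_, (DirectSum.decompose (gr k r) g n).2, ?_⟩
  have h1 := DirectSum.coe_decompose_mul_add_of_left_mem (gr k r) hℓ (b := g) (j := n)
  rw [Nat.add_comm 1 n, DirectSum.decompose_of_mem_same _ hf] at h1
  exact h1

/-- If the restriction of `f` to the hyperplane `ℓ = 0` is locally divisible by `x_a`, then `x_a`
divides the polynomial that represents it after elimination of a variable. -/
lemma X_dvd_elim (hℓ : ℓ ∈ gr k r 1) {c a : Fin (r + 1)} (hc : ℓ.coeff (Finsupp.single c 1) ≠ 0)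
    (hac : a ≠ c) {n : ℕ} {f : MvPolynomial (Fin (r + 1)) k} (hf : f ∈ gr k r (n + 1))
    (h : ∀ b, ∃ t, dehom (Hyperplane.ι ℓ) b le_rfl f = coord (Hyperplane.ι ℓ) a b le_rfl * t) :
    MvPolynomial.X a ∣ elim ℓ c f := by
  have h0 : ℓ ≠ 0 := by
    rintro rfl
    exact hc (MvPolynomial.coeff_zero _)
  have hX : Prime (MvPolynomial.X a : MvPolynomial (Fin (r + 1)) k) :=
    prime_of_isHomogeneous_one (coord_mem k a) (MvPolynomial.X_ne_zero a)
  by_contra hdvd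
  refine hdvd (Ideal.mem_span_singleton.mp (mem_of_forall_X_mem
    (I := (Ideal.span {MvPolynomial.X a}).comap (elim ℓ c)) (fun b => ?_) hf))
  rw [Ideal.mem_comap, Ideal.mem_span_singleton]
  obtain ⟨t, ht⟩ := h b
  obtain ⟨p, g, hg, rfl⟩ := exists_eq_dehom _ b t
  have h1 : MvPolynomial.X b ^ (p + 1) * f - MvPolynomial.X b ^ (n + 1) * (MvPolynomial.X a * g) ∈
      gr k r (p + 1 + (n + 1)) := by
    refine Submodule.sub_mem _ (X_pow_mul_mem b _ hf) ?_
    have h2 := X_pow_mul_mem b (n + 1) (MvPolynomial.IsHomogeneous.mul (coord_mem k a) hg)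
    rwa [show n + 1 + (1 + p) = p + 1 + (n + 1) by ring] at h2
  rcases dvd_or_dvd_of_dehom_eq_zero hℓ h0 b h1 (by
    simp only [map_sub, map_mul, map_pow, dehom_X, coord_self, one_pow, one_mul, ht, sub_self])
    with h2 | h2
  · have h3 := (elim_eq_zero_iff hℓ hc _).mpr h2
    rw [map_sub, map_mul, map_mul, map_mul, map_pow, elim_X_of_ne hac, sub_eq_zero] at h3
    have h4 : MvPolynomial.X a ∣ elim ℓ c (MvPolynomial.X b) ^ (p + 1) * elim ℓ c f := by
      rw [h3]
      exact (dvd_mul_right _ _).mul_left _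
    exact hX.dvd_of_dvd_pow ((hX.dvd_or_dvd h4).resolve_right hdvd)
  · rw [(elim_eq_zero_iff hℓ hc _).mpr h2]
    exact dvd_zero _

/-- Eliminating x_c fixes x_a, so the prime `ℓ` does not divide x_a, and x_a is regular on H. -/
lemma eq_zero_of_coord_mul_eq_zero (hℓ : ℓ ∈ gr k r 1) {c a : Fin (r + 1)}
    (hc : ℓ.coeff (Finsupp.single c 1) ≠ 0) (hac : a ≠ c) {b : Fin (r + 1)}
    {t : Fun (Hyperplane.ι ℓ) (chart (Hyperplane.ι ℓ) b)}
    (h : coord (Hyperplane.ι ℓ) a b le_rfl * t = 0) : t = 0 := by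
  have h0 : ℓ ≠ 0 := by
    rintro rfl
    exact hc (MvPolynomial.coeff_zero _)
  obtain ⟨p, g, hg, rfl⟩ := exists_eq_dehom _ b t
  rw [← dehom_X, ← map_mul] at h
  refine dehom_eq_zero_of_dvd hℓ h0 b le_rfl ?_
  refine (dvd_or_dvd_of_dehom_eq_zero hℓ h0 b
    (MvPolynomial.IsHomogeneous.mul (coord_mem k a) hg) h).imp_left fun h1 => ?_
  refine ((prime_of_isHomogeneous_one hℓ h0).dvd_or_dvd h1).resolve_left fun h2 => ?_
  have h3 := (elim_eq_zero_iff hℓ hc _).mpr h2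
  rw [elim_X_of_ne hac] at h3
  exact MvPolynomial.X_ne_zero a h3

lemma exists_dehom_eq_of_coord_mul_eq (hℓ : ℓ ∈ gr k r 1) {c a : Fin (r + 1)}
    (hc : ℓ.coeff (Finsupp.single c 1) ≠ 0) (hac : a ≠ c) {n : ℕ}
    {f : MvPolynomial (Fin (r + 1)) k} (hf : f ∈ gr k r (n + 1))
    {σ : ∀ b, Fun (Hyperplane.ι ℓ) (chart (Hyperplane.ι ℓ) b)}
    (h : ∀ b, coord (Hyperplane.ι ℓ) a b le_rfl * σ b = dehom (Hyperplane.ι ℓ) b le_rfl f) :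
    ∃ g ∈ gr k r n, ∀ b, σ b = dehom (Hyperplane.ι ℓ) b le_rfl g := by
  have h0 : ℓ ≠ 0 := by
    rintro rfl
    exact hc (MvPolynomial.coeff_zero _)
  obtain ⟨g, hg, hfg⟩ := exists_eq_mul_of_dvd (coord_mem k a) (isHomogeneous_elim hℓ c hf)
    (X_dvd_elim hℓ hc hac hf fun b => ⟨_, (h b).symm⟩)
  refine ⟨g, hg, fun b => sub_eq_zero.mp (eq_zero_of_coord_mul_eq_zero hℓ hc hac ?_)⟩
  rw [mul_sub, h, ← dehom_X, ← map_mul, ← hfg, ← map_sub]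
  exact dehom_eq_zero_of_dvd hℓ h0 b le_rfl
    (Or.inl (Ideal.mem_span_singleton.mp (sub_elim_mem c f)))

/-- With a single variable, ℙ^r is a point and the hyperplane is empty. -/
lemma subsingleton_H0_hyperplane (hℓ : ℓ ∈ gr k r 1) {c : Fin (r + 1)}
    (hc : ℓ.coeff (Finsupp.single c 1) ≠ 0) (h : ∀ a, a = c) :
    Subsingleton (H0 (Hyperplane.ι ℓ) m) := by
  have h0 : ℓ ≠ 0 := by
    rintro rfl
    exact hc (MvPolynomial.coeff_zero _)
  have h1 : ℓ ∣ MvPolynomial.X c := by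
    have h2 := eq_sum_coeff_smul_X hℓ
    rw [Fintype.sum_eq_single c fun a ha => (ha (h a)).elim] at h2
    refine ⟨MvPolynomial.C (ℓ.coeff (Finsupp.single c 1))⁻¹, ?_⟩
    conv_rhs => enter [1]; rw [← h2]
    rw [MvPolynomial.smul_eq_C_mul, mul_right_comm, ← map_mul, mul_inv_cancel₀ hc, map_one, one_mul]
  refine ⟨fun s t => Sec.ext fun b => ?_⟩
  have h2 : dehom (Hyperplane.ι ℓ) b (inf_le_right : ⊤ ⊓ chart (Hyperplane.ι ℓ) b ≤ _) 1 = 0 :=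
    dehom_eq_zero_of_dvd hℓ h0 b inf_le_right (Or.inr (h b ▸ h1))
  rw [map_one] at h2
  exact @Subsingleton.elim _ (subsingleton_of_zero_eq_one h2.symm) _ _

variable (m) in
-- For a variable x_a other than the eliminated one, some x_a ^ n s is a form on H. Its
-- representative without x_c is divisible by x_a in the polynomial ring, so the n factors cancel in
-- turn.
lemma polySec_hyperplane_surjective (hℓ : ℓ ∈ gr k r 1) (h0 : ℓ ≠ 0) :
    Function.Surjective (polySec (Hyperplane.ι ℓ) m ⊤) := by
  intro s
  obtain ⟨c, hc⟩ := exists_coeff_single_ne_zero hℓ h0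
  by_cases hr : ∀ a, a = c
  · have := subsingleton_H0_hyperplane (m := m) hℓ hc hr
    exact ⟨0, Subsingleton.elim _ _⟩
  push Not at hr
  obtain ⟨a, hac⟩ := hr
  let σ (b : Fin (r + 1)) : Fun (Hyperplane.ι ℓ) (chart (Hyperplane.ι ℓ) b) :=
    Fun.res _ (le_inf le_top le_rfl) (s.1 b)
  have key : ∀ n, ∀ f ∈ gr k r (m + n),
      (∀ b, coord (Hyperplane.ι ℓ) a b le_rfl ^ n * σ b = dehom (Hyperplane.ι ℓ) b le_rfl f) →
      ∃ f ∈ gr k r m, ∀ b, σ b = dehom (Hyperplane.ι ℓ) b le_rfl f := by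
    intro n
    induction n with
    | zero => exact fun f hf h => ⟨f, hf, fun b => by rw [← h, pow_zero, one_mul]⟩
    | succ n ih =>
      intro f hf h
      obtain ⟨g, hg, hgs⟩ := exists_dehom_eq_of_coord_mul_eq hℓ hc hac hf
        (σ := fun b => coord (Hyperplane.ι ℓ) a b le_rfl ^ n * σ b)
        fun b => by rw [← h, pow_succ', mul_assoc]
      exact ih g hg hgs
  obtain ⟨n, hn⟩ := exists_coord_pow_mul_eq_dehom s a
  obtain ⟨f, hf, hfs⟩ := hn n le_rfl
  obtain ⟨g, hg, hgs⟩ := key n f hf fun b => by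
    have h1 := congrArg (Fun.res _ (le_inf le_top le_rfl :
      chart (Hyperplane.ι ℓ) b ≤ ⊤ ⊓ chart (Hyperplane.ι ℓ) b)) (hfs b)
    rw [map_mul, map_pow, Fun.res_coord, res_dehom] at h1
    exact h1
  refine ⟨⟨g, hg⟩, Sec.ext fun b => ?_⟩
  rw [polySec_apply, ← res_dehom _ le_rfl inf_le_right, ← hgs, Fun.res_res, Fun.res_self]

end

/-! ### Dimension counts and failure of maximal rank. -/

noncomputable section
variable {k : Type u} [Field k] {r : ℕ} {X : Scheme.{u}} {i : X ⟶ PP k r}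
  {ℓ : MvPolynomial (Fin (r + 1)) k} {m : ℕ}

lemma finrank_gr (n : ℕ) : Module.finrank k (gr k r n) = (r + 1).multichoose n := by
  classical
  let s : Set (Fin (r + 1) →₀ ℕ) := {v | v.degree = n}
  have hs : s = (Finset.univ.finsuppAntidiag n : Finset (Fin (r + 1) →₀ ℕ)) := by
    ext v
    simp [s, Finsupp.degree_eq_sum]
  have e : gr k r n = AddMonoidAlgebra.supported k k s :=
    MvPolynomial.homogeneousSubmodule_eq_finsupp_supported _ _ n
  rw [e, (AddMonoidAlgebra.supportedEquivFinsupp s).finrank_eq, hs, Module.finrank_finsupp_self]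
  simp [Finset.card_finsuppAntidiag_nat_eq_multichoose]

lemma forall_dehom_eq_zero {f : gr k r m} (h : polySec i m ⊤ f = 0) (b : Fin (r + 1)) :
    dehom i b le_rfl f.1 = 0 := by
  have h1 := congrArg (fun s => Fun.res i (le_inf le_top le_rfl : chart i b ≤ ⊤ ⊓ chart i b)
    (s.1 b)) h
  rw [polySec_apply, res_dehom] at h1
  exact h1.trans (map_zero _)

/-- A nonzero linear form vanishing on every chart would make X factor through its hyperplane. -/
lemma polySec_one_injective [QuasiCompact i] (h : Nondegenerate i) :
    Function.Injective (polySec i 1 ⊤) := by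
  rw [injective_iff_map_eq_zero]
  intro f hf
  by_contra h0
  have h0' : f.1 ≠ 0 := fun h => h0 (Subtype.ext h)
  exact h f.1 f.2 h0' (exists_fac_hyperplane f.2 h0' i (forall_dehom_eq_zero hf))

lemma polySec_surjective_congr {j j' : X ⟶ PP k r} (e : j = j')
    (h : Function.Surjective (polySec j m ⊤)) : Function.Surjective (polySec j' m ⊤) := by
  subst e
  exact h

lemma polySec_eq_zero_congr {j j' : X ⟶ PP k r} (e : j = j') {f : gr k r m}
    (h : polySec j m ⊤ f = 0) : polySec j' m ⊤ f = 0 := by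
  subst e
  exact h

lemma pullback_surjective (hC : IsCurve i) (hℓ : ℓ ∈ gr k r 1) (h0 : ℓ ≠ 0)
    (hCℓ : ContainsNoComponent i ℓ) (hH : Subsingleton (H1 i m)) (n : ℕ) :
    Function.Surjective (pullback i (hyperplaneSectionι i ℓ) (m + n + 1)) := by
  have := discreteTopology_hyperplaneSection hC hℓ h0 hCℓ
  induction n with
  | zero => exact pullback_surjective_of_H1 hC hℓ h0 hCℓ hH
  | succ n ih => exact pullback_surjective_succ _ ih

lemma finrank_H0_add (hC : IsCurve i) (hℓ : ℓ ∈ gr k r 1) (h0 : ℓ ≠ 0)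
    (hCℓ : ContainsNoComponent i ℓ) (hH : Subsingleton (H1 i m)) (l n : ℕ) :
    Module.finrank k (H0 i (m + n)) =
      n * Module.finrank k (H0 (hyperplaneSectionι i ℓ ≫ i) l) + Module.finrank k (H0 i m) := by
  induction n with
  | zero => rw [Nat.zero_mul, Nat.zero_add, Nat.add_zero]
  | succ n ih =>
    rw [← Nat.add_assoc, finrank_H0_succ hC hℓ h0 hCℓ (finite_H0 hC hℓ h0 hCℓ _)
      (pullback_surjective hC hℓ h0 hCℓ hH n) l, ih]
    ring

lemma finrank_eq_of_hasDegreeGenus (hC : IsCurve i) (hℓ : ℓ ∈ gr k r 1) (h0 : ℓ ≠ 0)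
    (hCℓ : ContainsNoComponent i ℓ) (hH : Subsingleton (H1 i m)) {d g : ℤ}
    (h : HasDegreeGenus i d g) (l : ℕ) :
    (Module.finrank k (H0 (hyperplaneSectionι i ℓ ≫ i) l) : ℤ) = d ∧
      (Module.finrank k (H0 i m) : ℤ) = d * m + 1 - g := by
  obtain ⟨N, hN⟩ := Filter.eventually_atTop.mp h
  -- The dimension is linear in n from n = 0 on, so two consecutive large values determine slope and
  -- constant term.
  have h1 := hN (m + N) (by omega)
  have h2 := hN (m + (N + 1)) (by omega)
  rw [finrank_H0_add hC hℓ h0 hCℓ hH l] at h1 h2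
  push_cast at h1 h2
  have h3 : (Module.finrank k (H0 (hyperplaneSectionι i ℓ ≫ i) l) : ℤ) = d := by linarith
  rw [h3] at h1
  exact ⟨h3, by linarith⟩

lemma not_injective_restriction (hC : IsCurve i) (hℓ : ℓ ∈ gr k r 1)
    (h0 : ℓ ≠ 0) (hCℓ : ContainsNoComponent i ℓ)
    (h : Module.finrank k (H0 i (m + 1)) < Module.finrank k (gr k r (m + 1)))
    (hinj : Function.Injective (polySec i m ⊤)) :
    ¬ Function.Injective (restriction i ℓ (m + 1)) := by
  intro hres
  have := hC.isClosedImmersion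
  have := finite_H0 hC hℓ h0 hCℓ (m + 1)
  obtain ⟨q, hq, hq0⟩ := (Submodule.ne_bot_iff _).mp
    (LinearMap.ker_ne_bot_of_finrank_lt (f := polySec i (m + 1) ⊤) h)
  have h1 : polySec (hyperplaneSectionι i ℓ ≫ i) (m + 1) ⊤ q = 0 := by
    rw [← pullback_polySec, LinearMap.mem_ker.mp hq, map_zero]
  have h2 : polySec (Hyperplane.ι ℓ) (m + 1) ⊤ q = 0 := by
    refine (injective_iff_map_eq_zero _).mp hres _ ?_
    exact (pullback_polySec _ q).trans (polySec_eq_zero_congr Limits.pullback.condition h1)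
  obtain ⟨f, hf, hqf⟩ := exists_eq_mul_of_dvd hℓ q.2
    (dvd_of_forall_dehom_eq_zero hℓ h0 q.2 (forall_dehom_eq_zero h2))
  have h3 : mulSec i m ⊤ hℓ (polySec i m ⊤ ⟨f, hf⟩) = polySec i (m + 1) ⊤ q := Sec.ext fun b => by
    rw [mulSec_apply, polySec_apply, polySec_apply, hqf, map_mul]
  rw [LinearMap.mem_ker.mp hq] at h3
  have h4 : polySec i m ⊤ ⟨f, hf⟩ = 0 :=
    (injective_iff_map_eq_zero _).mp (mulSec_injective hC hℓ hCℓ affineOnCharts_top) _ h3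
  have h5 : f = 0 := congrArg Subtype.val ((injective_iff_map_eq_zero _).mp hinj _ h4)
  exact hq0 (Subtype.ext (by rw [hqf, h5, mul_zero]; rfl))

lemma not_surjective_restriction (hC : IsCurve i) (hℓ : ℓ ∈ gr k r 1)
    (h0 : ℓ ≠ 0) (hCℓ : ContainsNoComponent i ℓ)
    (h : Module.finrank k (H0 i (m + 1)) <
      Module.finrank k (H0 (hyperplaneSectionι i ℓ ≫ i) m) + Module.finrank k (gr k r m))
    (hinj : Function.Injective (polySec i m ⊤)) :
    ¬ Function.Surjective (restriction i ℓ (m + 1)) := by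
  intro hres
  have h1 : Function.Surjective (polySec (hyperplaneSectionι i ℓ ≫ i) (m + 1) ⊤) := by
    refine polySec_surjective_congr Limits.pullback.condition.symm fun z => ?_
    obtain ⟨s, rfl⟩ := hres z
    obtain ⟨q, rfl⟩ := polySec_hyperplane_surjective (m + 1) hℓ h0 s
    exact ⟨q, (pullback_polySec _ q).symm⟩
  have h2 : Function.Surjective (pullback i (hyperplaneSectionι i ℓ) (m + 1)) := fun z => by
    obtain ⟨q, rfl⟩ := h1 z
    exact ⟨polySec i (m + 1) ⊤ q, pullback_polySec _ q⟩
  have := finite_H0 hC hℓ h0 hCℓ m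
  have h3 := finrank_H0_succ hC hℓ h0 hCℓ (finite_H0 hC hℓ h0 hCℓ _) h2 m
  have h4 : Module.finrank k (gr k r m) ≤ Module.finrank k (H0 i m) :=
    LinearMap.finrank_le_finrank_of_injective hinj
  omega

end

end HyperplaneSection

theorem mainTheorem5 {k : Type u} [Field k] {r : ℕ} {C : Scheme.{u}}
    (i : C ⟶ HyperplaneSection.PP k r) (hC : HyperplaneSection.IsCurve i)
    (hnd : HyperplaneSection.Nondegenerate i) (d g : ℤ)
    (hdg : HyperplaneSection.HasDegreeGenus i d g)
    (hH1 : Subsingleton (HyperplaneSection.H1 i 2))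
    (h₁ : d < g + r) (h₂ : 4 * d - 2 * g < r * (r + 3))
    (ℓ : MvPolynomial (Fin (r + 1)) k) (hℓ : ℓ ∈ HyperplaneSection.gr k r 1) (hℓ0 : ℓ ≠ 0)
    (hCℓ : HyperplaneSection.ContainsNoComponent i ℓ) :
    ¬ HyperplaneSection.MaximalRank (HyperplaneSection.restriction i ℓ 2) := by
  have := hC.isClosedImmersion
  -- The final argument 1 is the twist on C ∩ H that occurs in `not_surjective_restriction` for `m =
  -- 1`.
  obtain ⟨h3, h4⟩ :=
    HyperplaneSection.finrank_eq_of_hasDegreeGenus hC hℓ hℓ0 hCℓ hH1 hdg 1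
  have hinj := HyperplaneSection.polySec_one_injective hnd
  rw [HyperplaneSection.MaximalRank, not_or]
  constructor
  -- The inequality 2(2d + 1 - g) < (r + 2)(r + 1) is `h₂`.
  · refine HyperplaneSection.not_injective_restriction hC hℓ hℓ0 hCℓ ?_ hinj
    have h5 : Module.finrank k (HyperplaneSection.gr k r 2) * 2 = (r + 2) * (r + 1) := by
      rw [HyperplaneSection.finrank_gr, Nat.multichoose_eq, Nat.choose_two_right,
        Nat.div_mul_cancel (Nat.even_mul_pred_self _).two_dvd]
      rfl
    zify at h5 ⊢
    rw [h4]
    push_cast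
    linarith
  -- The inequality 2d + 1 - g < d + (r + 1) is `h₁`.
  · refine HyperplaneSection.not_surjective_restriction hC hℓ hℓ0 hCℓ ?_ hinj
    rw [HyperplaneSection.finrank_gr, Nat.multichoose_one_right]
    zify
    rw [h3, h4]
    push_cast
    linarith
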